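/- Let $\mathbb F\in\{\mathbb R,\mathbb C\}$ and let $M$ be a Hausdorff smooth manifold. Write $R=C_c^\infty(M)$ for the (possibly non-unital) ring of smooth $\mathbb F$-valued functions with compact support on $M$; for $f\in R$ let $f_x$ be its germ at $x\in M$. A *sheaf* on $M$ is a local diffeomorphism $\pi:E\to M$ from a not necessarily Hausdorff smooth manifold $E$; a morphism of sheaves is a smooth map over $M$. An open set $U\subset E$ is *$\pi$-elementary* if $\pi|_U$ is injective. $C_c^\infty(E)$ is the set of finite sums, in the space of all (not necessarily continuous) sections of the sheaf of germs of smooth functions on $E$, of extensions by zero of smooth functions with compact support on Hausdorff open subsets of $E$. It is an $R$-module by $(pu)_y=(p\circ\pi)_y\,u_y$. For $U$ $\pi$-elementary and $f\in C_c^\infty(\pi(U))$, the extension by zero of $f\circ\pi|_U$ is an element of $C_c^\infty(E)$, again written $f\circ\pi|_U$. A local diffeomorphism $\phi:E\to F$ induces $\phi_+:C_c^\infty(E)\to C_c^\infty(F)$, $\phi_+(u)_z=\sum_{\phi(y)=z}(\phi_y^*)^{-1}(u_y)$, where $\phi_y^*$ is the pull-back isomorphism of germs. An *$R$-coalgebra*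 is an $R$-module $C$ that is locally unitary (for any finitely many $c_i\in C$ there is $r\in R$ with $rc_i=c_i$ for all $i$), with $R$-linear maps $\Delta:C\to C\otimes_RC$ and $\epsilon:C\to R$ such that $(\mathrm{id}\otimes\epsilon)\Delta=\mathrm{id}=(\epsilon\otimes\mathrm{id})\Delta$; homomorphisms are the $R$-linear maps compatible with $\Delta$ and $\epsilon$. $C_c^\infty(E)$ is an $R$-coalgebra with $\Delta=\Omega^{-1}\circ\mathrm{diag}_+$ and $\epsilon=\pi_+$, where $\mathrm{diag}:E\to E\times_ME$ is the diagonal and $\Omega:C_c^\infty(E)\otimes_RC_c^\infty(E)\to C_c^\infty(E\times_ME)$ is the isomorphism $\Omega(u\otimes v)_{(y,z)}=\mathrm{pr}_1^*(u_y)\,\mathrm{pr}_2^*(v_z)$; with $\phi\mapsto\phi_+$ this gives a functor $C_c^\infty$ from sheaves on $M$ to $R$-coalgebras. For an $R$-coalgebra $C$ and $x\in M$ let $C_x=C/N_x(C)$, where $N_x(C)=\{c\in C: fc=0\text{ for some }f\in R\text{ with }f_x=1\}$, and let $c_x$ be the class of $c$. Then $C_x$ is, with the induced maps $\Delta_x,\epsilon_x$,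 a coalgebra over the ring $R_x$ of germs at $x$ of smooth functions; let $G(C_x)=\{\zeta\in C_x:\Delta_x(\zeta)=\zeta\otimes\zeta,\ \epsilon_x(\zeta)=1\}$. An element $c\in C$ is *weakly grouplike* if $\Delta(c)=c\otimes c'$ for some $c'\in C$. The *spectral sheaf* $\mathcal E_{sp}(C)$ is the sheaf on $M$ with stalk $G(C_x)$ at $x$, whose topology has as basis the sets $c_W=\{c_x: x\in W\}$ with $W\subset M$ open and $c\in C$ weakly grouplike with $\epsilon(c)_x=1$ for all $x\in W$, and whose smooth structure is the one that makes the projection to $M$ a local diffeomorphism. A homomorphism $\alpha:C\to D$ of coalgebras induces $\mathcal E_{sp}(\alpha)$, given by $c_x\mapsto\alpha(c)_x$ on the stalk at $x$; so $\mathcal E_{sp}$ is a functor from $R$-coalgebras to sheaves on $M$. **Theorem.** There is a natural isomorphism $\Phi:\mathrm{id}\to\mathcal E_{sp}\circ C_c^\infty$ of functors from sheaves on $M$ to sheaves on $M$ such that for every sheaf $\pi:E\to M$ and every $y\in E$ $$\Phi_E(y)=(f\circ\pi|_U)_{\pi(y)}\in G\bigl(C_c^\infty(E)_{\pi(y)}\bigr)$$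 for every $\pi$-elementary $U\subset E$ with $y\in U$ and every $f\in C_c^\infty(\pi(U))$ with $f_{\pi(y)}=1$; such $U$ and $f$ exist for every $y$. In particular $(f\circ\pi|_U)_{\pi(y)}$ does not depend on the choice of $U$ and $f$, and $\Phi_E:E\to\mathcal E_{sp}(C_c^\infty(E))$ is an isomorphism of sheaves on $M$, natural in $E$. -/

import Mathlib

open Filter Topology CategoryTheory
open scoped Manifold ContDiff TensorProduct

universe u

set_option linter.unusedSectionVars false
set_option linter.unusedVariables false

namespace SheafCoalg

noncomputable section

/-! ### Étale spaces over a manifold and their smooth structure -/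

section Manifolds

variable {n : ℕ} {M : Type u} [TopologicalSpace M] [ChartedSpace (EuclideanSpace ℝ (Fin n)) M]

/-- The charts on `X` obtained from those of `M` through a local homeomorphism `p : X → M`. -/
@[reducible] def pullbackCharts {X : Type u} [TopologicalSpace X] (p : X → M)
    (hp : IsLocalHomeomorph p) : ChartedSpace (EuclideanSpace ℝ (Fin n)) X where
  atlas := Set.range fun x => (hp x).choose.trans (chartAt (EuclideanSpace ℝ (Fin n)) (p x))
  chartAt x := (hp x).choose.trans (chartAt (EuclideanSpace ℝ (Fin n)) (p x))
  mem_chart_source x := by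
    have h := (hp x).choose_spec
    simp only [OpenPartialHomeomorph.trans_source, Set.mem_inter_iff, Set.mem_preimage]
    refine ⟨h.1, ?_⟩
    rw [← h.2]; exact mem_chart_source _ _
  chart_mem_atlas x := ⟨x, rfl⟩

theorem pullbackCharts_isManifold {X : Type u} [TopologicalSpace X] (p : X → M)
    (hp : IsLocalHomeomorph p) [IsManifold (𝓡 n) ∞ M] :
    @IsManifold ℝ _ _ _ _ _ _ (𝓡 n) ∞ X _ (pullbackCharts p hp) := by
  let := pullbackCharts (n := n) p hp
  refine { compatible := ?_ }
  rintro _ _ ⟨x, rfl⟩ ⟨y, rfl⟩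
  set s₁ := (hp x).choose with hs₁
  set s₂ := (hp y).choose with hs₂
  have h₁ : p = s₁ := (hp x).choose_spec.2
  have h₂ : p = s₂ := (hp y).choose_spec.2
  set c₁ := chartAt (EuclideanSpace ℝ (Fin n)) (p x)
  set c₂ := chartAt (EuclideanSpace ℝ (Fin n)) (p y)
  have hc : c₁.symm.trans c₂ ∈ contDiffGroupoid ∞ (𝓡 n) :=
    HasGroupoid.compatible (chart_mem_atlas _ _) (chart_mem_atlas _ _)
  set T := (s₁.trans c₁).symm.trans (s₂.trans c₂)
  have key : ∀ z ∈ T.source, c₁.symm z ∈ c₂.source ∧ z ∈ c₁.target ∧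
      s₂ (s₁.symm (c₁.symm z)) = c₁.symm z := by
    intro z hz
    simp only [T, mfld_simps] at hz
    have : s₂ (s₁.symm (c₁.symm z)) = c₁.symm z := by
      rw [← h₂, h₁, s₁.right_inv hz.1.2]
    exact ⟨this ▸ hz.2.2, hz.1.1, this⟩
  refine (contDiffGroupoid ∞ (𝓡 n)).mem_of_eqOnSource
    (closedUnderRestriction' hc T.open_source) ⟨?_, ?_⟩
  · rw [OpenPartialHomeomorph.restr_source, T.open_source.interior_eq]
    refine (Set.inter_eq_right.2 fun z hz => ?_).symm
    simp only [mfld_simps]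
    exact ⟨(key z hz).2.1, (key z hz).1⟩
  · intro z hz
    have := (key z hz).2.2
    simp [T, this]

/-- A map into the source of a local diffeomorphism is smooth if it is continuous and its
composite with the local diffeomorphism is smooth. -/
theorem contMDiffAt_of_comp {X Y : Type u} [TopologicalSpace X] [TopologicalSpace Y]
    [ChartedSpace (EuclideanSpace ℝ (Fin n)) X] [ChartedSpace (EuclideanSpace ℝ (Fin n)) Y]
    {p : X → M} (hp : IsLocalDiffeomorph (𝓡 n) (𝓡 n) ∞ p) {g : Y → X} {y : Y}
    (hg : ContinuousAt g y) (hpg : ContMDiffAt (𝓡 n) (𝓡 n) ∞ (p ∘ g) y) :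
    ContMDiffAt (𝓡 n) (𝓡 n) ∞ g y := by
  have h := hp (g y)
  have h1 : ContMDiffAt (𝓡 n) (𝓡 n) ∞ (h.localInverse ∘ (p ∘ g)) y :=
    ContMDiffAt.comp y h.localInverse_contMDiffAt hpg
  refine h1.congr_of_eventuallyEq ?_
  filter_upwards [hg.eventually h.localInverse_eventuallyEq_left] with z hz
  exact hz.symm

theorem pullbackCharts_isLocalDiffeomorph {X : Type u} [TopologicalSpace X] (p : X → M)
    (hp : IsLocalHomeomorph p) [IsManifold (𝓡 n) ∞ M] :
    @IsLocalDiffeomorph ℝ _ _ _ _ _ _ _ _ _ _ _ (𝓡 n) (𝓡 n) X _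
      (pullbackCharts p hp) M _ _ ∞ p := by
  let := pullbackCharts (n := n) p hp
  have := pullbackCharts_isManifold (n := n) p hp
  have hchart : ∀ x, chartAt (EuclideanSpace ℝ (Fin n)) x =
    (hp x).choose.trans (chartAt (EuclideanSpace ℝ (Fin n)) (p x)) := fun x => rfl
  have hsm : ContMDiff (𝓡 n) (𝓡 n) ∞ p := by
    intro x
    have hx := mem_chart_source (EuclideanSpace ℝ (Fin n)) x
    have h1 : ContMDiffAt (𝓡 n) (𝓡 n) ∞ (chartAt (EuclideanSpace ℝ (Fin n)) x) x :=
      contMDiffOn_chart.contMDiffAt ((chartAt (EuclideanSpace ℝ (Fin n)) x).open_source.mem_nhds hx)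
    have h2 : ContMDiffAt (𝓡 n) (𝓡 n) ∞ (chartAt (EuclideanSpace ℝ (Fin n)) (p x)).symm
        (chartAt (EuclideanSpace ℝ (Fin n)) x x) := by
      refine contMDiffOn_chart_symm.contMDiffAt ((chartAt (EuclideanSpace ℝ (Fin n)) (p x)).open_target.mem_nhds ?_)
      have := (chartAt (EuclideanSpace ℝ (Fin n)) x).map_source hx
      rw [hchart x] at this ⊢
      simp only [mfld_simps] at this
      exact this.1
    refine (ContMDiffAt.comp x h2 h1).congr_of_eventuallyEq ?_
    filter_upwards [(chartAt (EuclideanSpace ℝ (Fin n)) x).open_source.mem_nhds hx] with z hz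
    rw [hchart x] at hz
    simp only [mfld_simps] at hz
    simp only [hchart x, Function.comp_apply, OpenPartialHomeomorph.coe_trans]
    rw [OpenPartialHomeomorph.left_inv _ hz.2]
    exact congrFun (hp x).choose_spec.2 z
  have hinv : ∀ x : X, ContMDiffAt (𝓡 n) (𝓡 n) ∞ (hp x).choose.symm (p x) := by
    intro x
    have hx := mem_chart_source (EuclideanSpace ℝ (Fin n)) x
    have hpx := mem_chart_source (EuclideanSpace ℝ (Fin n)) (p x)
    have h1 : ContMDiffAt (𝓡 n) (𝓡 n) ∞ (chartAt (EuclideanSpace ℝ (Fin n)) (p x)) (p x) :=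
      contMDiffOn_chart.contMDiffAt
        ((chartAt (EuclideanSpace ℝ (Fin n)) (p x)).open_source.mem_nhds hpx)
    have hcx : chartAt (EuclideanSpace ℝ (Fin n)) x x =
        chartAt (EuclideanSpace ℝ (Fin n)) (p x) (p x) := by
      rw [hchart x]; simp [← (hp x).choose_spec.2]
    have h2 : ContMDiffAt (𝓡 n) (𝓡 n) ∞ (chartAt (EuclideanSpace ℝ (Fin n)) x).symm
        (chartAt (EuclideanSpace ℝ (Fin n)) (p x) (p x)) := by
      rw [← hcx]
      exact contMDiffOn_chart_symm.contMDiffAt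
        ((chartAt (EuclideanSpace ℝ (Fin n)) x).open_target.mem_nhds
          ((chartAt (EuclideanSpace ℝ (Fin n)) x).map_source hx))
    refine (ContMDiffAt.comp (p x) h2 h1).congr_of_eventuallyEq ?_
    filter_upwards [(chartAt (EuclideanSpace ℝ (Fin n)) (p x)).open_source.mem_nhds hpx] with z hz
    simp only [hchart x, Function.comp_apply, OpenPartialHomeomorph.coe_trans_symm]
    rw [OpenPartialHomeomorph.left_inv _ hz]
  intro x
  refine ⟨{ toPartialEquiv := (hp x).choose.toPartialEquiv
            open_source := (hp x).choose.open_source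
            open_target := (hp x).choose.open_target
            contMDiffOn_toFun := ?_
            contMDiffOn_invFun := ?_ }, (hp x).choose_spec.1, fun z _ => ?_⟩
  · have : ((hp x).choose.toPartialEquiv : X → M) = p := (hp x).choose_spec.2.symm
    rw [this]; exact hsm.contMDiffOn
  · intro z hz
    refine ContMDiffAt.contMDiffWithinAt ?_
    set s := (hp x).choose
    have hs : p = s := (hp x).choose_spec.2
    change ContMDiffAt (𝓡 n) (𝓡 n) ∞ s.symm z
    have hz' : z ∈ s.target := hz
    set x' := s.symm z
    have hpx' : p x' = z := by rw [hs]; exact s.right_inv hz'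
    have h3 := hinv x'
    rw [hpx'] at h3
    refine h3.congr_of_eventuallyEq ?_
    have hc : ContinuousAt s.symm z := s.symm.continuousAt hz'
    filter_upwards [s.open_target.mem_nhds hz', hc.eventually
      ((hp x').choose.open_source.mem_nhds (hp x').choose_spec.1)] with w hw hw'
    have e1 : p (s.symm w) = w := by rw [hs]; exact s.right_inv hw
    have e2 := (hp x').choose.left_inv hw'
    rw [← (hp x').choose_spec.2, e1] at e2
    exact e2.symm
  · exact congrFun (hp x).choose_spec.2 z

variable (n M) in
/-- A sheaf (of sets) on the manifold `M`, as an étale space: a local diffeomorphism from a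
manifold, which need not be Hausdorff, to `M`. -/
structure Shf [IsManifold (𝓡 n) ∞ M] where
  /-- the total space -/
  carrier : Type u
  [top : TopologicalSpace carrier]
  [charts : ChartedSpace (EuclideanSpace ℝ (Fin n)) carrier]
  [mfd : IsManifold (𝓡 n) ∞ carrier]
  /-- the projection -/
  proj : carrier → M
  isLocalDiffeo : IsLocalDiffeomorph (𝓡 n) (𝓡 n) ∞ proj

attribute [instance] Shf.top Shf.charts Shf.mfd

variable [IsManifold (𝓡 n) ∞ M]

instance : CoeSort (Shf n M) (Type u) := ⟨Shf.carrier⟩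

theorem Shf.homeo (E : Shf n M) : IsLocalHomeomorph E.proj :=
  E.isLocalDiffeo.isLocalHomeomorph

/-- A morphism of sheaves on `M`: a smooth map over `M`. -/
structure Shf.Hom (E F : Shf n M) where
  toFun : E → F
  smooth : ContMDiff (𝓡 n) (𝓡 n) ∞ toFun
  proj_comp : ∀ y, F.proj (toFun y) = E.proj y

theorem Shf.Hom.ext' {E F : Shf n M} {φ ψ : Shf.Hom E F} (h : ∀ y, φ.toFun y = ψ.toFun y) :
    φ = ψ := by
  cases φ; cases ψ; congr; exact funext h

instance : Category (Shf n M) where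
  Hom := Shf.Hom
  id E := ⟨id, contMDiff_id, fun _ => rfl⟩
  comp φ ψ := ⟨ψ.toFun ∘ φ.toFun, ψ.smooth.comp φ.smooth,
    fun y => (ψ.proj_comp _).trans (φ.proj_comp y)⟩

/-- A continuous map over `M` is a morphism of sheaves. -/
def Shf.homMk {E F : Shf n M} (φ : E → F) (hφ : Continuous φ)
    (h : ∀ y, F.proj (φ y) = E.proj y) : E ⟶ F where
  toFun := φ
  proj_comp := h
  smooth y := contMDiffAt_of_comp F.isLocalDiffeo hφ.continuousAt <| by
    have : F.proj ∘ φ = E.proj := funext h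
    rw [this]; exact E.isLocalDiffeo.contMDiff y

theorem Shf.Hom.homeo {E F : Shf n M} (φ : E ⟶ F) : IsLocalHomeomorph φ.toFun := by
  refine IsLocalHomeomorph.of_comp (g := F.proj) ?_ F.homeo φ.smooth.continuous
  have : F.proj ∘ φ.toFun = E.proj := funext φ.proj_comp
  rw [this]; exact E.homeo

/-- A topological étale space over `M`, with the unique smooth structure for which the
projection is a local diffeomorphism. -/
def Shf.ofLocalHomeo {X : Type u} [TopologicalSpace X] (p : X → M) (hp : IsLocalHomeomorph p) :
    Shf n M :=
  letI := pullbackCharts (n := n) p hp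
  haveI := pullbackCharts_isManifold (n := n) p hp
  { carrier := X
    proj := p
    isLocalDiffeo := pullbackCharts_isLocalDiffeomorph p hp }

variable (n M) in
/-- The sheaf `id : M → M`. -/
def Shf.base : Shf n M where
  carrier := M
  proj := id
  isLocalDiffeo := (Diffeomorph.refl (𝓡 n) M ∞).isLocalDiffeomorph

/-- The projection of `E`, as a morphism of sheaves to `id : M → M`. -/
def Shf.projHom (E : Shf n M) : E ⟶ Shf.base n M :=
  ⟨E.proj, E.isLocalDiffeo.contMDiff, fun _ => rfl⟩

theorem fiberProd_homeo (E F : Shf n M) : IsLocalHomeomorph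
    (fun p : {p : E × F // E.proj p.1 = F.proj p.2} => E.proj p.1.1) := by
  refine E.homeo.comp (g := E.proj) (f := fun p : {p : E × F // E.proj p.1 = F.proj p.2} => p.1.1) ?_
  refine IsLocalHomeomorph.mk _ fun p => ?_
  obtain ⟨⟨y, z⟩, hp⟩ := p
  set s := (F.homeo z).choose with hs
  have h1 := (F.homeo z).choose_spec.1
  have h2 : F.proj = s := (F.homeo z).choose_spec.2
  have hc : Continuous fun p : {p : E × F // E.proj p.1 = F.proj p.2} => p.1.2 :=
    continuous_snd.comp continuous_subtype_val
  have hr : ∀ w, E.proj w ∈ s.target → E.proj w = F.proj (s.symm (E.proj w)) := fun w hw => by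
    rw [h2, s.right_inv hw]
  classical
  refine ⟨{
    toFun := fun p => p.1.1
    invFun := fun w => if h : E.proj w ∈ s.target then ⟨(w, s.symm (E.proj w)), hr w h⟩
      else ⟨(y, z), hp⟩
    source := {p | p.1.2 ∈ s.source}
    target := E.proj ⁻¹' s.target
    map_source' := ?_
    map_target' := ?_
    left_inv' := ?_
    right_inv' := ?_
    open_source := s.open_source.preimage hc
    open_target := s.open_target.preimage E.homeo.continuous
    continuousOn_toFun := (continuous_fst.comp continuous_subtype_val).continuousOn
    continuousOn_invFun := ?_ }, h1, fun p _ => rfl⟩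
  · rintro ⟨⟨a, b⟩, hab⟩ h
    change E.proj a ∈ s.target
    change E.proj a = F.proj b at hab
    rw [hab, h2]; exact s.map_source h
  · intro w hw
    have hw' : E.proj w ∈ s.target := hw
    simp only [hw', dif_pos, Set.mem_ofPred_eq]
    exact s.map_target hw'
  · rintro ⟨⟨a, b⟩, hab⟩ h
    change E.proj a = F.proj b at hab
    change b ∈ s.source at h
    have hw' : E.proj a ∈ s.target := by rw [hab, h2]; exact s.map_source h
    simp only [hw', dif_pos, Subtype.mk.injEq, Prod.mk.injEq, true_and]
    rw [hab, h2]; exact s.left_inv h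
  · intro w hw
    have hw' : E.proj w ∈ s.target := hw
    simp only [hw', dif_pos]
  · have hi : IsInducing (Subtype.val : {p : E × F // E.proj p.1 = F.proj p.2} → E × F) := ⟨rfl⟩
    rw [hi.continuousOn_iff]
    have : ContinuousOn (fun w => (w, s.symm (E.proj w))) (E.proj ⁻¹' s.target) :=
      continuousOn_id.prodMk
        (s.continuousOn_symm.comp E.homeo.continuous.continuousOn fun _ h => h)
    refine this.congr fun w hw => ?_
    have hw' : E.proj w ∈ s.target := hw
    simp only [Function.comp_apply, hw', dif_pos]

/-- The fibred product `E ×_M F`. -/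
def Shf.fiberProd (E F : Shf n M) : Shf n M :=
  Shf.ofLocalHomeo _ (fiberProd_homeo E F)

/-- The diagonal `E → E ×_M E`. -/
def Shf.diag (E : Shf n M) : E ⟶ E.fiberProd E :=
  Shf.homMk (F := E.fiberProd E) (fun y => ⟨(y, y), rfl⟩)
    (Continuous.subtype_mk (continuous_id.prodMk continuous_id) _) fun _ => rfl

/-- An open subset of `E` on which the projection is injective. -/
def Shf.Elementary (E : Shf n M) (U : Set E) : Prop :=
  IsOpen U ∧ Set.InjOn E.proj U

end Manifolds

/-! ### Modules and coalgebras over a commutative ring that need not have an identity -/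

section Modules

/-- The ring obtained from `R` by adjoining an identity. A module over the non-unital ring `R` is
the same as a unital module over this ring, and tensor products over `R` are the same as tensor
products over this ring. -/
def Uz (R : Type u) [NonUnitalCommRing R] : Type u := Unitization ℤ R

variable {R : Type u} [NonUnitalCommRing R]

instance : CommRing (Uz R) := inferInstanceAs (CommRing (Unitization ℤ R))

/-- The inclusion of `R` into the ring obtained by adjoining an identity. -/
def Uz.of : R →ₙ+* Uz R where
  toFun r := (Unitization.inr r : Unitization ℤ R)
  map_mul' r s := Unitization.inr_mul ℤ r s
  map_zero' := Unitization.inr_zero ℤ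
  map_add' r s := Unitization.inr_add ℤ r s

/-- The extension of a homomorphism from `R` to a unital ring. -/
def Uz.lift {S : Type*} [Ring S] (φ : R →ₙ+* S) : Uz R →+* S :=
  (Unitization.lift ({ φ with map_smul' := fun m r => map_zsmul φ m r } : R →ₙₐ[ℤ] S)).toRingHom

@[simp] theorem Uz.lift_of {S : Type*} [Ring S] (φ : R →ₙ+* S) (r : R) :
    Uz.lift φ (Uz.of r) = φ r := by
  change (Unitization.lift ({ φ with map_smul' := fun m r => map_zsmul φ m r } : R →ₙₐ[ℤ] S))
    (Unitization.inr r) = _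
  simp

theorem Uz.induction {p : Uz R → Prop} (a : Uz R) (h1 : ∀ m : ℤ, p m)
    (h2 : ∀ r, p (Uz.of r)) (h3 : ∀ a b, p a → p b → p (a + b)) : p a := by
  refine Unitization.ind (fun m r => ?_) a
  refine h3 _ _ ?_ (h2 r)
  have : (Unitization.inl m : Unitization ℤ R) = (m : Uz R) := by
    exact (map_intCast (Unitization.inlRingHom ℤ R) m)
  rw [this]; exact h1 m

/-- The action of `r : R` on an element of an `R`-module. -/
def act {C : Type*} [AddCommGroup C] [Module (Uz R) C] (r : R) (c : C) : C :=
  Uz.of r • c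

section act

variable {C D : Type*} [AddCommGroup C] [Module (Uz R) C] [AddCommGroup D] [Module (Uz R) D]
  (r s : R) (c d : C) (a : Uz R)

theorem act_mul : act (r * s) c = act r (act s c) := by
  simp only [act, map_mul, mul_smul]

@[simp] theorem act_zero : act r (0 : C) = 0 := smul_zero _
theorem act_add : act r (c + d) = act r c + act r d := smul_add _ _ _
theorem act_sub : act r (c - d) = act r c - act r d := smul_sub _ _ _
theorem add_act : act (r + s) c = act r c + act s c := by simp only [act, map_add, add_smul]
theorem act_smul : act r (a • c) = a • act r c := smul_comm _ _ _
theorem map_act (α : C →ₗ[Uz R] D) : α (act r c) = act r (α c) := map_smul _ _ _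

theorem act_tmul (e : D) : act r (c ⊗ₜ[Uz R] e) = act r c ⊗ₜ e := TensorProduct.smul_tmul' _ _ _

theorem act_tmul' (e : D) : act r (c ⊗ₜ[Uz R] e) = c ⊗ₜ act r e :=
  (TensorProduct.tmul_smul _ _ _).symm

end act

/-- `R` as a module over itself. -/
instance selfModule : Module (Uz R) R :=
  Module.compHom R (Uz.lift (S := Module.End ℤ R)
    { toFun := fun r => LinearMap.mulLeft ℤ r
      map_mul' := fun r s => by ext t; simp
      map_zero' := by ext t; simp
      map_add' := fun r s => by ext t; simp [add_mul] })

theorem selfModule_act (r s : R) : act r s = r * s := by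
  change (Uz.lift (S := Module.End ℤ R) _ (Uz.of r)) s = _
  rw [Uz.lift_of]; rfl

theorem Uz.of_smul (a : Uz R) (r : R) : Uz.of (a • r) = a * Uz.of r := by
  induction a using Uz.induction with
  | h1 m => rw [Int.cast_smul_eq_zsmul, map_zsmul, zsmul_eq_mul]
  | h2 s => rw [← map_mul, ← selfModule_act]; rfl
  | h3 a b ha hb => rw [add_smul, map_add, ha, hb, add_mul]

variable (R) in
/-- The bilinear action map `c, r ↦ r c`. -/
def actHom (C : Type*) [AddCommGroup C] [Module (Uz R) C] : C →ₗ[Uz R] R →ₗ[Uz R] C :=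
  LinearMap.mk₂ (Uz R) (fun c r => act r c) (fun _ _ _ => smul_add _ _ _)
    (fun a c r => smul_comm _ _ _)
    (fun c r s => add_act _ _ _)
    (fun a c r => by rw [act, Uz.of_smul, mul_smul]; rfl)

/-- `id ⊗ ε`, with `C ⊗ R` identified with `C`. -/
def idTensor {C : Type*} [AddCommGroup C] [Module (Uz R) C] (ε : C →ₗ[Uz R] R) :
    C ⊗[Uz R] C →ₗ[Uz R] C :=
  TensorProduct.lift (actHom R C) ∘ₗ TensorProduct.map LinearMap.id ε

/-- `ε ⊗ id`, with `R ⊗ C` identified with `C`. -/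
def tensorId {C : Type*} [AddCommGroup C] [Module (Uz R) C] (ε : C →ₗ[Uz R] R) :
    C ⊗[Uz R] C →ₗ[Uz R] C :=
  TensorProduct.lift (actHom R C).flip ∘ₗ TensorProduct.map ε LinearMap.id

@[simp] theorem idTensor_tmul {C : Type*} [AddCommGroup C] [Module (Uz R) C] (ε : C →ₗ[Uz R] R)
    (c d : C) : idTensor ε (c ⊗ₜ d) = act (ε d) c := rfl

@[simp] theorem tensorId_tmul {C : Type*} [AddCommGroup C] [Module (Uz R) C] (ε : C →ₗ[Uz R] R)
    (c d : C) : tensorId ε (c ⊗ₜ d) = act (ε c) d := rfl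

variable (R) in
/-- A coalgebra over `R`: a locally unitary `R`-module with a comultiplication and a counit. -/
structure Coalg where
  carrier : Type u
  [addCommGroup : AddCommGroup carrier]
  [module : Module (Uz R) carrier]
  locallyUnitary : ∀ s : Finset carrier, ∃ r : R, ∀ c ∈ s, act r c = c
  comul : carrier →ₗ[Uz R] carrier ⊗[Uz R] carrier
  counit : carrier →ₗ[Uz R] R
  id_counit : ∀ c, idTensor counit (comul c) = c
  counit_id : ∀ c, tensorId counit (comul c) = c

attribute [instance] Coalg.addCommGroup Coalg.module

instance : CoeSort (Coalg R) (Type u) := ⟨Coalg.carrier⟩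

/-- A homomorphism of coalgebras. -/
structure Coalg.Hom (C D : Coalg R) where
  lin : C →ₗ[Uz R] D
  comul_comp : ∀ c, TensorProduct.map lin lin (C.comul c) = D.comul (lin c)
  counit_comp : ∀ c, D.counit (lin c) = C.counit c

theorem Coalg.Hom.ext' {C D : Coalg R} {α β : Coalg.Hom C D} (h : ∀ c, α.lin c = β.lin c) :
    α = β := by
  cases α; cases β; congr; exact LinearMap.ext h

instance : Category (Coalg R) where
  Hom := Coalg.Hom
  id C := ⟨LinearMap.id, fun c => by simp, fun _ => rfl⟩
  comp α β := ⟨β.lin ∘ₗ α.lin,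
    fun c => by rw [TensorProduct.map_comp, LinearMap.comp_apply, α.comul_comp, β.comul_comp]; rfl,
    fun c => (β.counit_comp _).trans (α.counit_comp c)⟩

/-- The weakly grouplike elements: `Δ(c) = c ⊗ c'` for some `c'`. -/
def Coalg.WeaklyGrouplike (C : Coalg R) (c : C) : Prop :=
  ∃ c' : C, C.comul c = c ⊗ₜ c'

end Modules

/-! ### The ring of smooth functions with compact support on a Hausdorff manifold -/

section Base

variable (𝕜 : Type) [RCLike 𝕜] (n : ℕ) (M : Type u) [TopologicalSpace M]
  [ChartedSpace (EuclideanSpace ℝ (Fin n)) M]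

/-- The non-unital ring of smooth `𝕜`-valued functions with compact support on `M`. -/
def smoothCompact : NonUnitalSubring (M → 𝕜) where
  carrier := {f | ContMDiff (𝓡 n) 𝓘(ℝ, 𝕜) ∞ f ∧ HasCompactSupport f}
  zero_mem' := ⟨contMDiff_const, HasCompactSupport.zero⟩
  add_mem' hf hg := ⟨hf.1.add hg.1, hf.2.add hg.2⟩
  neg_mem' hf := ⟨hf.1.neg, hf.2.neg⟩
  mul_mem' hf hg := ⟨contDiff_mul.contMDiff.comp (hf.1.prodMk_space hg.1), hf.2.mul_right⟩

/-- `C_c^∞(M)`. -/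
def Rc : Type u := smoothCompact 𝕜 n M

instance : NonUnitalCommRing (Rc 𝕜 n M) := inferInstanceAs (NonUnitalCommRing (smoothCompact 𝕜 n M))

instance : CoeFun (Rc 𝕜 n M) (fun _ => M → 𝕜) := ⟨fun f => f.1⟩

variable {𝕜 n M} in
theorem Rc.ext {f g : Rc 𝕜 n M} (h : ∀ x, f x = g x) : f = g := Subtype.ext (funext h)

section

variable {𝕜 n M} (f g : Rc 𝕜 n M) (x : M)

@[simp] theorem Rc.add_apply : (f + g) x = f x + g x := rfl
@[simp] theorem Rc.sub_apply : (f - g) x = f x - g x := rfl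
@[simp] theorem Rc.neg_apply : (-f) x = -f x := rfl
@[simp] theorem Rc.mul_apply : (f * g) x = f x * g x := rfl
@[simp] theorem Rc.zero_apply : (0 : Rc 𝕜 n M) x = 0 := rfl

end


variable {𝕜 n M}

/-- `f` equals `1` on a neighbourhood of `x`, i.e. its germ at `x` is `1`. -/
def OneAt (f : Rc 𝕜 n M) (x : M) : Prop := f.1 =ᶠ[𝓝 x] 1

theorem OneAt.mul {f g : Rc 𝕜 n M} {x : M} (hf : OneAt f x) (hg : OneAt g x) :
    OneAt (f * g) x := by
  filter_upwards [hf, hg] with y h1 h2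
  simp [h1, h2]

theorem exists_bump [T2Space M] [IsManifold (𝓡 n) ∞ M] (x : M) {W : Set M} (hW : W ∈ 𝓝 x) :
    ∃ b : Rc 𝕜 n M, OneAt b x ∧ tsupport b.1 ⊆ W := by
  obtain ⟨f, -, hf⟩ := (SmoothBumpFunction.nhds_basis_tsupport (I := 𝓡 n) x).mem_iff.1 hW
  have hs : tsupport (fun y => (RCLike.ofReal (f y) : 𝕜)) ⊆ tsupport f := by
    refine closure_mono fun y hy => ?_
    simpa using hy
  refine ⟨⟨fun y => (RCLike.ofReal (f y) : 𝕜), ?_, ?_⟩, ?_, hs.trans hf⟩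
  · exact (RCLike.ofRealCLM (K := 𝕜)).contDiff.contMDiff.comp f.contMDiff
  · exact f.hasCompactSupport.mono (by intro y hy; simpa using hy)
  · filter_upwards [f.eventuallyEq_one] with y hy
    simp [hy]

theorem exists_one_on_compact [T2Space M] [IsManifold (𝓡 n) ∞ M] {K O : Set M} (hK : IsCompact K)
    (hO : IsOpen O) (hKO : K ⊆ O) :
    ∃ r : Rc 𝕜 n M, (∀ x ∈ K, OneAt r x) ∧ tsupport r.1 ⊆ O := by
  refine hK.induction_on (p := fun K => ∃ r : Rc 𝕜 n M, (∀ x ∈ K, OneAt r x) ∧ tsupport r.1 ⊆ O)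
    ⟨0, by simp, by simp [tsupport, show (0 : Rc 𝕜 n M).1 = 0 from rfl]⟩
    (fun s t hst h => h.imp fun r hr => ⟨fun x hx => hr.1 x (hst hx), hr.2⟩) ?_ ?_
  · rintro s t ⟨r, hr, hr'⟩ ⟨q, hq, hq'⟩
    refine ⟨r + q - r * q, ?_, ?_⟩
    · rintro x (hx | hx)
      · filter_upwards [hr x hx] with y hy
        simp [hy]
      · filter_upwards [hq x hx] with y hy
        simp [hy]
    · refine subset_trans (closure_minimal (t := tsupport r.1 ∪ tsupport q.1) (fun y hy => ?_)
        ((isClosed_tsupport _).union (isClosed_tsupport _))) (Set.union_subset hr' hq')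
      by_contra h
      rw [Set.mem_union, not_or] at h
      have h1 : r y = 0 := image_eq_zero_of_notMem_tsupport h.1
      have h2 : q y = 0 := image_eq_zero_of_notMem_tsupport h.2
      exact hy (by change r y + q y - r y * q y = 0; simp [h1, h2])
  · intro x hx
    obtain ⟨b, hb, hb'⟩ := exists_bump (𝕜 := 𝕜) (n := n) x (hO.mem_nhds (hKO hx))
    exact ⟨_, mem_nhdsWithin_of_mem_nhds (eventually_eventually_nhds.2 hb), b, fun y hy => hy, hb'⟩

/-! ### Localization of modules and coalgebras at a point -/

variable [T2Space M] [IsManifold (𝓡 n) ∞ M]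

variable (𝕜 n) in
/-- `N_x(C)`: the elements annihilated by a function which equals `1` near `x`. -/
def nullAt (x : M) (C : Type*) [AddCommGroup C] [Module (Uz (Rc 𝕜 n M)) C] :
    Submodule (Uz (Rc 𝕜 n M)) C where
  carrier := {c | ∃ f : Rc 𝕜 n M, OneAt f x ∧ act f c = 0}
  zero_mem' := (exists_bump x univ_mem).imp fun f hf => ⟨hf.1, act_zero _⟩
  add_mem' := by
    rintro c d ⟨f, hf, hc⟩ ⟨g, hg, hd⟩
    refine ⟨f * g, hf.mul hg, ?_⟩
    rw [act_add, mul_comm, act_mul, hc, mul_comm, act_mul, hd]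
    simp
  smul_mem' := by
    rintro a c ⟨f, hf, hc⟩
    exact ⟨f, hf, by rw [act_smul, hc, smul_zero]⟩

variable (𝕜 n) in
/-- `C_x = C / N_x(C)`. -/
abbrev Loc (x : M) (C : Type*) [AddCommGroup C] [Module (Uz (Rc 𝕜 n M)) C] :=
  C ⧸ nullAt 𝕜 n x C

variable (𝕜 n) in
/-- The class `c_x` of `c` in `C_x`. -/
abbrev Loc.mk (x : M) {C : Type*} [AddCommGroup C] [Module (Uz (Rc 𝕜 n M)) C] (c : C) : Loc 𝕜 n x C :=
  (nullAt 𝕜 n x C).mkQ c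

theorem Loc.act_eq {x : M} {C : Type*} [AddCommGroup C] [Module (Uz (Rc 𝕜 n M)) C]
    {f : Rc 𝕜 n M} (hf : OneAt f x) (c : C) : Loc.mk 𝕜 n x (act f c) = Loc.mk 𝕜 n x c := by
  obtain ⟨g, hg, hgs⟩ := exists_bump (𝕜 := 𝕜) (n := n) x (eventually_eventually_nhds.2 hf)
  refine (Submodule.Quotient.eq _).2 ⟨g, hg, ?_⟩
  have : g * f = g := by
    refine Rc.ext fun y => ?_
    by_cases hy : g y = 0
    · simp [hy]
    · have : y ∈ tsupport g.1 := subset_tsupport _ hy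
      have := (hgs this).self_of_nhds
      simp [this]
  rw [act_sub, ← act_mul, this, sub_self]

/-- The map `α_x : C_x → D_x` induced by a linear map. -/
def Loc.map (x : M) {C D : Type*} [AddCommGroup C] [Module (Uz (Rc 𝕜 n M)) C]
    [AddCommGroup D] [Module (Uz (Rc 𝕜 n M)) D] (α : C →ₗ[Uz (Rc 𝕜 n M)] D) :
    Loc 𝕜 n x C →ₗ[Uz (Rc 𝕜 n M)] Loc 𝕜 n x D :=
  Submodule.mapQ _ _ α <| by
    rintro c ⟨f, hf, hc⟩
    exact ⟨f, hf, by rw [← map_act, hc, map_zero]⟩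

variable (𝕜 n) in
/-- The canonical surjection `C ⊗ C → C_x ⊗ C_x`. -/
abbrev Loc.tensor (x : M) (C : Type*) [AddCommGroup C] [Module (Uz (Rc 𝕜 n M)) C] :
    C ⊗[Uz (Rc 𝕜 n M)] C →ₗ[Uz (Rc 𝕜 n M)] Loc 𝕜 n x C ⊗[Uz (Rc 𝕜 n M)] Loc 𝕜 n x C :=
  TensorProduct.map (nullAt 𝕜 n x C).mkQ (nullAt 𝕜 n x C).mkQ

/-- The kernel of `C ⊗ C → C_x ⊗ C_x` is `N_x(C ⊗ C)`. -/
theorem Loc.tensor_eq_zero_iff {x : M} {C : Type*} [AddCommGroup C] [Module (Uz (Rc 𝕜 n M)) C]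
    (t : C ⊗[Uz (Rc 𝕜 n M)] C) :
    Loc.tensor 𝕜 n x C t = 0 ↔ t ∈ nullAt 𝕜 n x (C ⊗[Uz (Rc 𝕜 n M)] C) := by
  constructor
  · intro h
    let B : C →ₗ[Uz (Rc 𝕜 n M)] C →ₗ[Uz (Rc 𝕜 n M)] Loc 𝕜 n x (C ⊗[Uz (Rc 𝕜 n M)] C) :=
      (TensorProduct.mk (Uz (Rc 𝕜 n M)) C C).compr₂ (nullAt 𝕜 n x _).mkQ
    have h1 : nullAt 𝕜 n x C ≤ LinearMap.ker B := by
      rintro c ⟨f, hf, hc⟩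
      refine LinearMap.ext fun d => (Submodule.Quotient.mk_eq_zero _).2 ⟨f, hf, ?_⟩
      change act f (c ⊗ₜ d) = 0
      rw [act_tmul, hc, TensorProduct.zero_tmul]
    have h2 : nullAt 𝕜 n x C ≤ LinearMap.ker B.flip := by
      rintro c ⟨f, hf, hc⟩
      refine LinearMap.ext fun d => (Submodule.Quotient.mk_eq_zero _).2 ⟨f, hf, ?_⟩
      change act f (d ⊗ₜ c) = 0
      rw [act_tmul', hc, TensorProduct.tmul_zero]
    have h3 : (TensorProduct.lift (B.liftQ₂ (nullAt 𝕜 n x C) (nullAt 𝕜 n x C) h1 h2)) ∘ₗ Loc.tensor 𝕜 n x C =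
        (nullAt 𝕜 n x (C ⊗[Uz (Rc 𝕜 n M)] C)).mkQ := by
      refine TensorProduct.ext' fun c d => ?_
      rfl
    have h4 := LinearMap.congr_fun h3 t
    rw [LinearMap.comp_apply, h, map_zero] at h4
    exact (Submodule.Quotient.mk_eq_zero _).1 h4.symm
  · rintro ⟨f, hf, ht⟩
    have h : ∀ t : C ⊗[Uz (Rc 𝕜 n M)] C, Loc.tensor 𝕜 n x C (act f t) = Loc.tensor 𝕜 n x C t := by
      intro t
      induction t using TensorProduct.induction_on with
      | zero => simp
      | tmul c d =>
        rw [act_tmul, TensorProduct.map_tmul, TensorProduct.map_tmul]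
        exact congrArg (fun e => e ⊗ₜ _) (Loc.act_eq hf c)
      | add s t hs ht =>
        rw [act_add, map_add, map_add]; exact congrArg₂ _ hs ht
    rw [← h, ht, map_zero]

variable (C : Coalg (Rc 𝕜 n M)) (x : M)

/-- The comultiplication `Δ_x : C_x → C_x ⊗ C_x` induced by `Δ`. The tensor product over
`C_c^∞(M)` of two modules over the ring of germs at `x` is their tensor product over that ring,
because `C_c^∞(M)` maps onto it. -/
def Coalg.comulAt : Loc 𝕜 n x C →ₗ[Uz (Rc 𝕜 n M)] Loc 𝕜 n x C ⊗[Uz (Rc 𝕜 n M)] Loc 𝕜 n x C :=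
  (nullAt 𝕜 n x C).liftQ (Loc.tensor 𝕜 n x C ∘ₗ C.comul) <| by
    rintro c ⟨f, hf, hc⟩
    refine (Loc.tensor_eq_zero_iff _).2 ⟨f, hf, ?_⟩
    rw [← map_act, hc, map_zero]

/-- The counit `ε_x : C_x → (C^∞_M)_x` induced by `ε`. -/
def Coalg.counitAt : Loc 𝕜 n x C →+ Germ (𝓝 x) 𝕜 :=
  QuotientAddGroup.lift (nullAt 𝕜 n x C).toAddSubgroup
    ((Germ.coeAddHom (𝓝 x)).comp
      ((smoothCompact 𝕜 n M).toAddSubgroup.subtype.comp C.counit.toAddMonoidHom)) <| by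
    rintro c ⟨f, hf, hc⟩
    have h : f * C.counit c = 0 := by
      rw [← selfModule_act, ← map_act, hc, map_zero]
    refine (Germ.coe_eq (f := (C.counit c).1) (g := 0)).2 ?_
    filter_upwards [hf] with y hy
    have := congrArg (fun r : Rc 𝕜 n M => r y) h
    simpa [hy] using this

/-- The grouplike elements of `C_x`. -/
def Coalg.Grouplike (ζ : Loc 𝕜 n x C) : Prop :=
  C.comulAt x ζ = ζ ⊗ₜ ζ ∧ C.counitAt x ζ = 1

end Base

/-! ### The spectral sheaf of a coalgebra -/

section Spectral

variable {𝕜 : Type} [RCLike 𝕜] {n : ℕ} {M : Type u} [TopologicalSpace M]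
  [ChartedSpace (EuclideanSpace ℝ (Fin n)) M] [T2Space M] [IsManifold (𝓡 n) ∞ M]

theorem Coalg.comulAt_mk (C : Coalg (Rc 𝕜 n M)) (x : M) (c : C) :
    C.comulAt x (Loc.mk 𝕜 n x c) = Loc.tensor 𝕜 n x C (C.comul c) := rfl

theorem Coalg.counitAt_mk (C : Coalg (Rc 𝕜 n M)) (x : M) (c : C) :
    C.counitAt x (Loc.mk 𝕜 n x c) = ((C.counit c).1 : Germ (𝓝 x) 𝕜) := rfl

theorem Coalg.counitAt_mk_eq_one (C : Coalg (Rc 𝕜 n M)) (x : M) (c : C) :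
    C.counitAt x (Loc.mk 𝕜 n x c) = 1 ↔ OneAt (C.counit c) x :=
  Germ.coe_eq (f := (C.counit c).1) (g := 1)

theorem Coalg.WeaklyGrouplike.grouplike {C : Coalg (Rc 𝕜 n M)} {c : C} (hc : C.WeaklyGrouplike c)
    {x : M} (hx : OneAt (C.counit c) x) : C.Grouplike x (Loc.mk 𝕜 n x c) := by
  obtain ⟨c', h⟩ := hc
  refine ⟨?_, (C.counitAt_mk_eq_one x c).2 hx⟩
  have h1 : act (C.counit c) c' = c := by
    have := C.counit_id c
    rwa [h, tensorId_tmul] at this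
  have h2 : Loc.mk 𝕜 n x c' = Loc.mk 𝕜 n x c := by
    rw [← Loc.act_eq hx, h1]
  rw [C.comulAt_mk, h, TensorProduct.map_tmul]
  exact congrArg _ h2

theorem Coalg.Grouplike.exists_rep {C : Coalg (Rc 𝕜 n M)} {x : M} {ζ : Loc 𝕜 n x C}
    (hζ : C.Grouplike x ζ) :
    ∃ c : C, C.WeaklyGrouplike c ∧ OneAt (C.counit c) x ∧ ζ = Loc.mk 𝕜 n x c := by
  obtain ⟨c, rfl⟩ := Submodule.mkQ_surjective _ ζ
  have h1 := (C.counitAt_mk_eq_one x c).1 hζ.2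
  have h2 : Loc.tensor 𝕜 n x C (C.comul c - c ⊗ₜ c) = 0 := by
    rw [map_sub, TensorProduct.map_tmul, sub_eq_zero]
    exact hζ.1
  obtain ⟨f, hf, h⟩ := (Loc.tensor_eq_zero_iff _).1 h2
  refine ⟨act f c, ⟨c, ?_⟩, ?_, (Loc.act_eq hf c).symm⟩
  · rw [act_sub, sub_eq_zero, act_tmul] at h
    rw [map_act, h]
  · rw [map_act, selfModule_act]; exact hf.mul h1

/-- The total space of the spectral sheaf: its stalk at `x` is the set of grouplike elements of
`C_x`. -/
structure Coalg.Sp (C : Coalg (Rc 𝕜 n M)) : Type u where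
  pt : M
  val : Loc 𝕜 n pt C
  grouplike : C.Grouplike pt val

theorem Coalg.Sp.ext' {C : Coalg (Rc 𝕜 n M)} {p q : C.Sp} (h : p.pt = q.pt)
    (h' : HEq p.val q.val) : p = q := by
  cases p; cases q; cases h; cases h'; rfl

/-- The set `c_W` of the classes `c_x` with `x ∈ W`. -/
def Coalg.basic (C : Coalg (Rc 𝕜 n M)) (c : C) (W : Set M) : Set C.Sp :=
  {p | p.pt ∈ W ∧ p.val = Loc.mk 𝕜 n p.pt c}

/-- The sets `c_W`, for `W` open and `c` weakly grouplike and normalized on `W`. -/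
def Coalg.basis (C : Coalg (Rc 𝕜 n M)) : Set (Set C.Sp) :=
  {S | ∃ (c : C) (W : Set M), IsOpen W ∧ C.WeaklyGrouplike c ∧ (∀ x ∈ W, OneAt (C.counit c) x) ∧
    S = C.basic c W}

instance (C : Coalg (Rc 𝕜 n M)) : TopologicalSpace C.Sp :=
  TopologicalSpace.generateFrom C.basis

theorem Coalg.isTopologicalBasis (C : Coalg (Rc 𝕜 n M)) :
    TopologicalSpace.IsTopologicalBasis C.basis where
  eq_generateFrom := rfl
  sUnion_eq := by
    refine Set.eq_univ_of_forall fun p => ?_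
    obtain ⟨c, hc, h1, h2⟩ := p.grouplike.exists_rep
    obtain ⟨W, hW, hWo, hx⟩ := mem_nhds_iff.1 (eventually_eventually_nhds.2 h1)
    exact ⟨_, ⟨c, W, hWo, hc, fun x hx => hW hx, rfl⟩, hx, h2⟩
  exists_subset_inter := by
    rintro _ ⟨c, W, hW, hc, hcW, rfl⟩ _ ⟨d, V, hV, hd, hdV, rfl⟩ p ⟨⟨hp1, hp2⟩, hp3, hp4⟩
    obtain ⟨f, hf, h⟩ := (Submodule.Quotient.eq _).1 (hp2.symm.trans hp4)
    obtain ⟨X, hX, hXo, hx⟩ := mem_nhds_iff.1 (eventually_eventually_nhds.2 hf)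
    refine ⟨_, ⟨c, W ∩ V ∩ X, (hW.inter hV).inter hXo, hc, fun x hx => hcW x hx.1.1, rfl⟩,
      ⟨⟨⟨hp1, hp3⟩, hx⟩, hp2⟩, ?_⟩
    rintro q ⟨⟨⟨hq1, hq2⟩, hq3⟩, hq4⟩
    exact ⟨⟨hq1, hq4⟩, hq2, hq4.trans ((Submodule.Quotient.eq _).2 ⟨f, hX hq3, h⟩)⟩

theorem Coalg.sp_homeo (C : Coalg (Rc 𝕜 n M)) : IsLocalHomeomorph (fun p : C.Sp => p.pt) := by
  have hcont : Continuous (fun p : C.Sp => p.pt) := by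
    refine continuous_def.2 fun V hV => C.isTopologicalBasis.isOpen_iff.2 fun p hp => ?_
    obtain ⟨_, ⟨c, W, hW, hc, hcW, rfl⟩, hpS, -⟩ :=
      C.isTopologicalBasis.mem_nhds_iff.1 (univ_mem (f := 𝓝 p))
    exact ⟨_, ⟨c, W ∩ V, hW.inter hV, hc, fun x hx => hcW x hx.1, rfl⟩, ⟨⟨hpS.1, hp⟩, hpS.2⟩,
      fun q hq => hq.1.2⟩
  have hopen : IsOpenMap (fun p : C.Sp => p.pt) := by
    refine C.isTopologicalBasis.isOpenMap_iff.2 ?_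
    rintro _ ⟨c, W, hW, hc, hcW, rfl⟩
    convert hW
    ext x
    refine ⟨?_, fun hx => ⟨⟨x, _, hc.grouplike (hcW x hx)⟩, ⟨hx, rfl⟩, rfl⟩⟩
    rintro ⟨p, hp, rfl⟩
    exact hp.1
  refine isLocalHomeomorph_iff_isOpenEmbedding_restrict.2 fun p => ?_
  obtain ⟨S, hS, hpS, -⟩ := C.isTopologicalBasis.mem_nhds_iff.1 (univ_mem (f := 𝓝 p))
  have hSo := C.isTopologicalBasis.isOpen hS
  refine ⟨S, hSo.mem_nhds hpS, .of_continuous_injective_isOpenMap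
    (hcont.comp continuous_subtype_val) ?_ (hopen.comp hSo.isOpenMap_subtype_val)⟩
  obtain ⟨c, W, hW, hc, hcW, rfl⟩ := hS
  rintro ⟨⟨x, ζ, h1⟩, hp⟩ ⟨⟨y, ξ, h2⟩, hq⟩ h
  obtain rfl : x = y := h
  obtain rfl : ζ = ξ := hp.2.trans hq.2.symm
  rfl

/-- The spectral sheaf of a coalgebra. -/
def Coalg.spectral (C : Coalg (Rc 𝕜 n M)) : Shf n M :=
  Shf.ofLocalHomeo _ C.sp_homeo

theorem Coalg.Grouplike.map {C D : Coalg (Rc 𝕜 n M)} (α : C ⟶ D) {x : M} {ζ : Loc 𝕜 n x C}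
    (hζ : C.Grouplike x ζ) : D.Grouplike x (Loc.map x α.lin ζ) := by
  obtain ⟨c, rfl⟩ := Submodule.mkQ_surjective _ ζ
  have h1 : C.counitAt x (Loc.mk 𝕜 n x c) = 1 := hζ.2
  have h2 := hζ.1
  refine ⟨?_, ?_⟩
  · have key : ∀ t : C ⊗[Uz (Rc 𝕜 n M)] C,
        Loc.tensor 𝕜 n x D (TensorProduct.map α.lin α.lin t) =
          TensorProduct.map (Loc.map x α.lin) (Loc.map x α.lin) (Loc.tensor 𝕜 n x C t) := by
      intro t
      induction t using TensorProduct.induction_on with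
      | zero => simp
      | tmul c d => rfl
      | add s t hs ht => simp only [map_add, hs, ht]
    change Loc.tensor 𝕜 n x D (D.comul (α.lin c)) = _
    rw [← α.comul_comp, key]
    exact congrArg (TensorProduct.map (Loc.map x α.lin) (Loc.map x α.lin)) h2
  · rw [C.counitAt_mk_eq_one, ← α.counit_comp] at h1
    exact (D.counitAt_mk_eq_one x _).2 h1

/-- The map induced by a homomorphism of coalgebras, given by `α_x` on the stalk at `x`. -/
def Coalg.Sp.map {C D : Coalg (Rc 𝕜 n M)} (α : C ⟶ D) (p : C.Sp) : D.Sp :=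
  ⟨p.pt, Loc.map p.pt α.lin p.val, p.grouplike.map α⟩

theorem Coalg.Sp.continuous_map {C D : Coalg (Rc 𝕜 n M)} (α : C ⟶ D) :
    Continuous (Coalg.Sp.map α) := by
  refine continuous_iff_continuousAt.2 fun p => ?_
  obtain ⟨c, hc, h1, h2⟩ := p.grouplike.exists_rep
  refine (D.isTopologicalBasis.nhds_hasBasis.tendsto_right_iff).2 ?_
  rintro _ ⟨⟨d, V, hV, hd, hdV, rfl⟩, hp1, hp2⟩
  have h3 : Loc.mk 𝕜 n p.pt (α.lin c) = Loc.mk 𝕜 n p.pt d := by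
    refine Eq.trans ?_ hp2
    change _ = Loc.map p.pt α.lin p.val
    rw [h2]; rfl
  obtain ⟨f, hf, h⟩ := (Submodule.Quotient.eq _).1 h3
  obtain ⟨X, hX, hXo, hx⟩ := mem_nhds_iff.1
    (eventually_eventually_nhds.2 (hf.and (h1.and (hV.mem_nhds hp1))))
  have hX' : ∀ y ∈ X, OneAt f y ∧ OneAt (C.counit c) y ∧ y ∈ V := fun y hy =>
    ⟨(hX hy).mono fun _ h => h.1, (hX hy).mono fun _ h => h.2.1, (hX hy).self_of_nhds.2.2⟩
  refine Filter.mem_of_superset ((C.isTopologicalBasis.isOpen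
    ⟨c, X, hXo, hc, fun y hy => (hX' y hy).2.1, rfl⟩).mem_nhds ⟨hx, h2⟩) ?_
  rintro q ⟨hq1, hq2⟩
  refine ⟨(hX' _ hq1).2.2, ?_⟩
  change Loc.map q.pt α.lin q.val = _
  rw [hq2]
  exact (Submodule.Quotient.eq _).2 ⟨f, (hX' _ hq1).1, h⟩

variable (𝕜 n M) in
/-- The spectral sheaf functor. -/
def spectralFunctor : Coalg (Rc 𝕜 n M) ⥤ Shf n M where
  obj C := C.spectral
  map {C D} α := Shf.homMk (E := C.spectral) (F := D.spectral) (Coalg.Sp.map α)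
    (Coalg.Sp.continuous_map α) fun _ => rfl
  map_id C := Shf.Hom.ext' fun p => by
    refine Coalg.Sp.ext' rfl (heq_of_eq ?_)
    obtain ⟨c, hc⟩ := Submodule.mkQ_surjective _ p.val
    change Loc.map p.pt LinearMap.id p.val = p.val
    rw [← hc]; rfl
  map_comp {C D B} α β := Shf.Hom.ext' fun p => by
    refine Coalg.Sp.ext' rfl (heq_of_eq ?_)
    obtain ⟨c, hc⟩ := Submodule.mkQ_surjective _ p.val
    change Loc.map p.pt (β.lin ∘ₗ α.lin) p.val = Loc.map p.pt β.lin (Loc.map p.pt α.lin p.val)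
    rw [← hc]; rfl

end Spectral

/-! ### Smooth functions with compact support on the total space of a sheaf -/

section Sections

variable {𝕜 : Type} [RCLike 𝕜] {n : ℕ} {M : Type u} [TopologicalSpace M]
  [ChartedSpace (EuclideanSpace ℝ (Fin n)) M] [IsManifold (𝓡 n) ∞ M]

theorem Shf.Elementary.mono {E : Shf n M} {U V : Set E} (hU : E.Elementary U) (hV : IsOpen V)
    (h : V ⊆ U) : E.Elementary V := ⟨hV, hU.2.mono h⟩

theorem Shf.exists_elementary (E : Shf n M) (y : E) {W : Set E} (hW : W ∈ 𝓝 y) :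
    ∃ V, E.Elementary V ∧ y ∈ V ∧ V ⊆ W := by
  obtain ⟨V, hVW, hVo, hy⟩ := mem_nhds_iff.1 hW
  obtain ⟨V', hVo', hy', hV'⟩ : ∃ V', IsOpen V' ∧ y ∈ V' ∧ Set.InjOn E.proj V' :=
    ⟨_, (E.homeo y).choose.open_source, (E.homeo y).choose_spec.1, by
      have h := (E.homeo y).choose.injOn
      rwa [← (E.homeo y).choose_spec.2] at h⟩
  exact ⟨V ∩ V', ⟨hVo.inter hVo', hV'.mono Set.inter_subset_right⟩, ⟨hy, hy'⟩,
    Set.inter_subset_left.trans hVW⟩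

theorem Shf.Elementary.exists_section {E : Shf n M} {U : Set E} (hU : E.Elementary U)
    (hne : U.Nonempty) : ∃ s : M → E, ContMDiffOn (𝓡 n) (𝓡 n) ∞ s (E.proj '' U) ∧
      ∀ y ∈ U, s (E.proj y) = y := by
  have : Nonempty E := hne.to_type
  have hs : ∀ y ∈ U, Function.invFunOn E.proj U (E.proj y) = y :=
    fun y hy => hU.2.leftInvOn_invFunOn hy
  refine ⟨Function.invFunOn E.proj U, ?_, hs⟩
  rintro _ ⟨y, hy, rfl⟩
  refine ContMDiffAt.contMDiffWithinAt (contMDiffAt_of_comp E.isLocalDiffeo ?_ ?_)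
  · rw [ContinuousAt, hs y hy, ← E.homeo.map_nhds_eq, tendsto_map'_iff]
    refine tendsto_id.congr' ?_
    filter_upwards [hU.1.mem_nhds hy] with z hz
    exact (hs z hz).symm
  · refine contMDiffAt_id.congr_of_eventuallyEq ?_
    filter_upwards [(E.homeo.isOpenMap U hU.1).mem_nhds ⟨y, hy, rfl⟩]
    rintro _ ⟨z, hz, rfl⟩
    simp [hs z hz]

variable (𝕜) in
/-- Global sections, not necessarily continuous, of the sheaf of germs of functions on `E`. -/
def Sections (E : Shf n M) : Type u := ∀ y : E, Germ (𝓝 y) 𝕜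

instance (E : Shf n M) : CommRing (Sections 𝕜 E) :=
  inferInstanceAs (CommRing (∀ y : E, Germ (𝓝 y) 𝕜))

/-- The module structure on sections: `(p u)_y` is the product of the germ of `p ∘ π` and `u_y`. -/
instance (E : Shf n M) : Module (Uz (Rc 𝕜 n M)) (Sections 𝕜 E) :=
  Module.compHom (Sections 𝕜 E) (Uz.lift (S := Sections 𝕜 E)
    { toFun := fun p y => (((p : M → 𝕜) ∘ E.proj : E → 𝕜) : Germ (𝓝 y) 𝕜)
      map_mul' := fun _ _ => rfl
      map_zero' := rfl
      map_add' := fun _ _ => rfl })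

theorem act_apply {E : Shf n M} (p : Rc 𝕜 n M) (u : Sections 𝕜 E) (y : E) :
    (act p u : Sections 𝕜 E) y = ((p.1 ∘ E.proj : E → 𝕜) : Germ (𝓝 y) 𝕜) * u y := by
  change ((Uz.lift (S := Sections 𝕜 E) _ (Uz.of p)) * u : Sections 𝕜 E) y = _
  rw [Uz.lift_of]; rfl

open Classical in
/-- The section which is the germ of `f` at the points of `U` and zero elsewhere. -/
def extByZero {E : Shf n M} (U : Set E) (f : E → 𝕜) : Sections 𝕜 E :=
  fun y => if y ∈ U then (f : Germ (𝓝 y) 𝕜) else 0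

theorem extByZero_of_mem {E : Shf n M} {U : Set E} {f : E → 𝕜} {y : E} (hy : y ∈ U) :
    extByZero U f y = (f : Germ (𝓝 y) 𝕜) := if_pos hy

theorem extByZero_of_notMem {E : Shf n M} {U : Set E} {f : E → 𝕜} {y : E} (hy : y ∉ U) :
    extByZero U f y = 0 := if_neg hy

theorem extByZero_add {E : Shf n M} (U : Set E) (f g : E → 𝕜) :
    extByZero U (f + g) = extByZero U f + extByZero U g := by
  funext y
  change _ = extByZero U f y + extByZero U g y
  by_cases hy : y ∈ U
  · simp only [extByZero_of_mem hy]; rfl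
  · simp only [extByZero_of_notMem hy, add_zero]

theorem extByZero_neg {E : Shf n M} (U : Set E) (f : E → 𝕜) :
    extByZero U (-f) = -extByZero U f := by
  funext y
  change _ = -extByZero U f y
  by_cases hy : y ∈ U
  · simp only [extByZero_of_mem hy]; rfl
  · simp only [extByZero_of_notMem hy, neg_zero]

theorem act_extByZero {E : Shf n M} (p : Rc 𝕜 n M) (U : Set E) (f : E → 𝕜) :
    act p (extByZero U f) = extByZero U ((p.1 ∘ E.proj) * f) := by
  funext y
  rw [act_apply]
  by_cases hy : y ∈ U
  · simp only [extByZero_of_mem hy]; rfl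
  · simp only [extByZero_of_notMem hy, mul_zero]

/-- `f` is smooth on `U` and has compact support in `U`. -/
def SmoothCompactOn {E : Shf n M} (U : Set E) (f : E → 𝕜) : Prop :=
  ContMDiffOn (𝓡 n) 𝓘(ℝ, 𝕜) ∞ f U ∧
    ∃ K, IsCompact K ∧ K ⊆ U ∧ ∀ y ∈ U, y ∉ K → f y = 0

theorem SmoothCompactOn.neg {E : Shf n M} {U : Set E} {f : E → 𝕜} (hf : SmoothCompactOn U f) :
    SmoothCompactOn U (-f) := by
  obtain ⟨hf, K, hK, hKU, hK0⟩ := hf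
  exact ⟨hf.neg, K, hK, hKU, fun y hy h => by simp [hK0 y hy h]⟩

theorem SmoothCompactOn.mul_left {E : Shf n M} {U : Set E} {f p : E → 𝕜}
    (hf : SmoothCompactOn U f) (hp : ContMDiffOn (𝓡 n) 𝓘(ℝ, 𝕜) ∞ p U) :
    SmoothCompactOn U (p * f) := by
  obtain ⟨hf, K, hK, hKU, hK0⟩ := hf
  exact ⟨contDiff_mul.contMDiff.comp_contMDiffOn (hp.prodMk_space hf), K, hK, hKU,
    fun y hy h => by simp [hK0 y hy h]⟩

theorem SmoothCompactOn.add {E : Shf n M} {U : Set E} {f p : E → 𝕜}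
    (hf : SmoothCompactOn U f) (hp : SmoothCompactOn U p) : SmoothCompactOn U (f + p) := by
  obtain ⟨hf, K, hK, hKU, hK0⟩ := hf
  obtain ⟨hp, L, hL, hLU, hL0⟩ := hp
  refine ⟨hf.add hp, K ∪ L, hK.union hL, Set.union_subset hKU hLU, fun y hy h => ?_⟩
  rw [Set.mem_union, not_or] at h
  simp [hK0 y hy h.1, hL0 y hy h.2]

variable (𝕜) in
/-- The extensions by zero of smooth functions with compact support in Hausdorff open subsets. -/
def generators (E : Shf n M) : Set (Sections 𝕜 E) :=
  {u | ∃ (U : Set E) (f : E → 𝕜), IsOpen U ∧ T2Space U ∧ SmoothCompactOn U f ∧ u = extByZero U f}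

variable (𝕜) in
/-- `C_c^∞(E)`: the finite sums of extensions by zero of smooth functions with compact support in
Hausdorff open subsets of `E`. -/
def Cc (E : Shf n M) : Submodule (Uz (Rc 𝕜 n M)) (Sections 𝕜 E) where
  __ := AddSubgroup.closure (generators 𝕜 E)
  smul_mem' := by
    intro a u hu
    change u ∈ AddSubgroup.closure _ at hu
    change a • u ∈ AddSubgroup.closure _
    induction a using Uz.induction with
    | h1 m => rw [Int.cast_smul_eq_zsmul]; exact AddSubgroup.zsmul_mem _ hu m
    | h2 p =>
      change act p u ∈ _
      induction hu using AddSubgroup.closure_induction with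
      | mem u hu =>
        obtain ⟨U, f, hU, hT, hf, rfl⟩ := hu
        rw [act_extByZero]
        exact AddSubgroup.subset_closure ⟨U, _, hU, hT, hf.mul_left
          (p.2.1.comp_contMDiffOn E.isLocalDiffeo.contMDiff.contMDiffOn), rfl⟩
      | zero => rw [act_zero]; exact zero_mem _
      | add u v _ _ hu hv => rw [act_add]; exact add_mem hu hv
      | neg u _ hu => rw [act, smul_neg]; exact neg_mem hu
    | h3 a b ha hb => rw [add_smul]; exact add_mem ha hb

/-- `U` is elementary and `f` has support in `π(U)`. -/
structure Adapted {E : Shf n M} (U : Set E) (f : Rc 𝕜 n M) : Prop where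
  elementary : E.Elementary U
  supp : tsupport f.1 ⊆ E.proj '' U

theorem Adapted.smoothCompactOn {E : Shf n M} {U : Set E} {f : Rc 𝕜 n M} (h : Adapted U f) :
    SmoothCompactOn U (f.1 ∘ E.proj) := by
  refine ⟨f.2.1.comp_contMDiffOn E.isLocalDiffeo.contMDiff.contMDiffOn, ?_⟩
  rcases U.eq_empty_or_nonempty with rfl | hne
  · exact ⟨∅, isCompact_empty, subset_rfl, by simp⟩
  obtain ⟨s, hs, hs'⟩ := h.elementary.exists_section hne
  refine ⟨s '' tsupport f.1, f.2.2.isCompact.image_of_continuousOn (hs.continuousOn.mono h.supp),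
    ?_, fun y hy hyK => ?_⟩
  · rintro _ ⟨x, hx, rfl⟩
    obtain ⟨y, hy, rfl⟩ := h.supp hx
    rwa [hs' y hy]
  · by_contra h0
    exact hyK ⟨E.proj y, subset_tsupport _ h0, hs' y hy⟩

theorem Adapted.of_zero {E : Shf n M} {U : Set E} {f : Rc 𝕜 n M} (h : Adapted U f)
    {g : Rc 𝕜 n M} (hg : ∀ x, f x = 0 → g x = 0) : Adapted U g :=
  ⟨h.elementary, (closure_mono fun x (hx : g x ≠ 0) h0 => hx (hg x h0)).trans h.supp⟩

theorem Adapted.mul {E : Shf n M} {U : Set E} {f : Rc 𝕜 n M} (h : Adapted U f) (r : Rc 𝕜 n M) :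
    Adapted U (r * f) := h.of_zero fun x hx => by simp [hx]

variable [T2Space M]

theorem Adapted.mem_generators {E : Shf n M} {U : Set E} {f : Rc 𝕜 n M} (h : Adapted U f) :
    extByZero U (f.1 ∘ E.proj) ∈ generators 𝕜 E := by
  refine ⟨U, _, h.elementary.1, ?_, h.smoothCompactOn, rfl⟩
  exact T2Space.of_injective_continuous (f := fun y : U => E.proj y)
    (fun a b hab => Subtype.ext (h.elementary.2 a.2 b.2 hab))
    (E.homeo.continuous.comp continuous_subtype_val)

/-- The function `f ∘ π|_U`, extended by zero. -/
def Cc.piece {E : Shf n M} (U : Set E) (f : Rc 𝕜 n M) (h : Adapted U f) : Cc 𝕜 E :=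
  ⟨extByZero U (f.1 ∘ E.proj), AddSubgroup.subset_closure h.mem_generators⟩

variable (𝕜) in
/-- The sums of functions `f ∘ π|_U`. -/
def pieces (E : Shf n M) : AddSubmonoid (Sections 𝕜 E) :=
  AddSubmonoid.closure {u | ∃ (U : Set E) (f : Rc 𝕜 n M), Adapted U f ∧
    u = extByZero U (f.1 ∘ E.proj)}

/-- A partition of unity argument on a Hausdorff open subset. -/
theorem extByZero_mem_pieces {E : Shf n M} {U : Set E} (hU : IsOpen U) (hT : T2Space U)
    {f : E → 𝕜} (hf : SmoothCompactOn U f) : extByZero U f ∈ pieces 𝕜 E := by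
  have hsub : ∀ K : Set E, IsCompact K → K ⊆ U → ∃ ψ : E → 𝕜,
      ContMDiffOn (𝓡 n) 𝓘(ℝ, 𝕜) ∞ ψ U ∧ (∀ y ∈ K, ψ y = 1) ∧
        ∀ f, SmoothCompactOn U f → extByZero U (ψ * f) ∈ pieces 𝕜 E := by
    intro K hK hKU
    refine hK.induction_on (p := fun K => ∃ ψ : E → 𝕜,
      ContMDiffOn (𝓡 n) 𝓘(ℝ, 𝕜) ∞ ψ U ∧ (∀ y ∈ K, ψ y = 1) ∧
        ∀ f, SmoothCompactOn U f → extByZero U (ψ * f) ∈ pieces 𝕜 E) ?_ ?_ ?_ ?_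
    · refine ⟨0, contMDiffOn_const, by simp, fun f hf => ?_⟩
      have : extByZero U ((0 : E → 𝕜) * f) = 0 := by
        funext y
        by_cases hy : y ∈ U
        · rw [extByZero_of_mem hy, zero_mul]; rfl
        · rw [extByZero_of_notMem hy]; rfl
      rw [this]; exact zero_mem _
    · exact fun s t hst ⟨ψ, h1, h2, h3⟩ => ⟨ψ, h1, fun y hy => h2 y (hst hy), h3⟩
    · rintro s t ⟨ψ, h1, h2, h3⟩ ⟨θ, g1, g2, g3⟩
      have h4 : ContMDiffOn (𝓡 n) 𝓘(ℝ, 𝕜) ∞ (1 - ψ) U :=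
        (contMDiffOn_const (c := (1 : 𝕜))).sub h1
      have h5 : ContMDiffOn (𝓡 n) 𝓘(ℝ, 𝕜) ∞ (θ * (1 - ψ)) U :=
        contDiff_mul.contMDiff.comp_contMDiffOn (g1.prodMk_space h4)
      refine ⟨ψ + θ * (1 - ψ), h1.add h5, ?_, fun f hf => ?_⟩
      · rintro y (hy | hy)
        · simp [h2 y hy]
        · simp [g2 y hy]
      · have : (ψ + θ * (1 - ψ)) * f = ψ * f + θ * (f + -(ψ * f)) := by ring
        rw [this, extByZero_add]
        exact add_mem (h3 f hf) (g3 _ (hf.add (hf.mul_left h1).neg))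
    · intro y hyK
      obtain ⟨V, hV, hyV, hVU⟩ := E.exists_elementary y (hU.mem_nhds (hKU hyK))
      obtain ⟨s, hs, hs'⟩ := hV.exists_section ⟨y, hyV⟩
      have hVo := E.homeo.isOpenMap V hV.1
      obtain ⟨b, hb, hbV⟩ := exists_bump (𝕜 := 𝕜) (n := n) (E.proj y) (hVo.mem_nhds ⟨y, hyV, rfl⟩)
      classical
      set ψ : E → 𝕜 := fun w => if w ∈ V then b (E.proj w) else 0 with hψ
      have hψV : ∀ w ∈ V, ψ =ᶠ[𝓝 w] b.1 ∘ E.proj := fun w hw => by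
        filter_upwards [hV.1.mem_nhds hw] with z hz
        simp [hψ, hz]
      have hL : IsCompact (s '' tsupport b.1) :=
        b.2.2.isCompact.image_of_continuousOn (hs.continuousOn.mono hbV)
      have hψ0 : ∀ w ∈ U, w ∉ V → ψ =ᶠ[𝓝 w] 0 := fun w hw hwV => by
        have hLU : s '' tsupport b.1 ⊆ V := by
          rintro _ ⟨x, hx, rfl⟩
          obtain ⟨z, hz, rfl⟩ := hbV hx
          rwa [hs' z hz]
        have h1 : IsCompact (Subtype.val ⁻¹' (s '' tsupport b.1) : Set U) := by
          refine Topology.IsInducing.subtypeVal.isCompact_preimage_iff ?_ |>.2 hL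
          rw [Subtype.range_coe]; exact hLU.trans hVU
        have h2 := hU.isOpenMap_subtype_val _ h1.isClosed.isOpen_compl
        filter_upwards [h2.mem_nhds ⟨⟨w, hw⟩, fun h => hwV (hLU h), rfl⟩]
        rintro _ ⟨⟨z, hz⟩, hzL, rfl⟩
        by_cases hzV : z ∈ V
        · have : b (E.proj z) = 0 := by
            by_contra h0
            exact hzL ⟨E.proj z, subset_tsupport _ h0, hs' z hzV⟩
          simp [hψ, this]
        · simp [hψ, hzV]
      have hψs : ContMDiffOn (𝓡 n) 𝓘(ℝ, 𝕜) ∞ ψ U := by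
        intro w hw
        refine ContMDiffAt.contMDiffWithinAt ?_
        by_cases hwV : w ∈ V
        · exact ((b.2.1.comp E.isLocalDiffeo.contMDiff) w).congr_of_eventuallyEq (hψV w hwV)
        · exact (contMDiffAt_const (c := (0 : 𝕜))).congr_of_eventuallyEq (hψ0 w hw hwV)
      refine ⟨{z | ψ z = 1}, ?_, ψ, hψs, fun z hz => hz, fun f hf => ?_⟩
      · refine mem_nhdsWithin_of_mem_nhds ?_
        filter_upwards [hψV y hyV, E.homeo.continuous.continuousAt.eventually hb] with z hz hz'
        exact hz.trans hz'
      · let h : M → 𝕜 := fun x => b x * f (s x)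
        have hsupp : tsupport h ⊆ tsupport b.1 := closure_mono fun x hx => by
          intro h0
          exact hx (by simp [h, show b x = 0 from h0])
        have hh : ContMDiff (𝓡 n) 𝓘(ℝ, 𝕜) ∞ h := by
          refine contMDiff_of_tsupport fun x hx => ?_
          have hxV := hbV (hsupp hx)
          obtain ⟨z, hz, rfl⟩ := id hxV
          have e1 : ContMDiffAt (𝓡 n) 𝓘(ℝ, 𝕜) ∞ f (s (E.proj z)) := by
            rw [hs' z hz]; exact hf.1.contMDiffAt (hU.mem_nhds (hVU hz))
          have e2 : ContMDiffAt (𝓡 n) 𝓘(ℝ, 𝕜) ∞ (f ∘ s) (E.proj z) :=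
            e1.comp _ (hs.contMDiffAt (hVo.mem_nhds hxV))
          exact contDiff_mul.contMDiff.contMDiffAt.comp _ ((b.2.1 _).prodMk_space e2)
        refine AddSubmonoid.subset_closure ⟨V, ⟨h, hh, b.2.2.mono' (subset_closure.trans hsupp)⟩,
          ⟨hV, hsupp.trans hbV⟩, ?_⟩
        funext w
        by_cases hwV : w ∈ V
        · rw [extByZero_of_mem hwV, extByZero_of_mem (hVU hwV), Germ.coe_eq]
          filter_upwards [hψV w hwV, hV.1.mem_nhds hwV] with z hz hzV
          simp [hz, h, hs' z hzV]
        · rw [extByZero_of_notMem hwV]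
          by_cases hwU : w ∈ U
          · rw [extByZero_of_mem hwU]
            refine (Germ.coe_eq (f := ψ * f) (g := 0)).2 ?_
            filter_upwards [hψ0 w hwU hwV] with z hz
            simp [hz]
          · rw [extByZero_of_notMem hwU]
  obtain ⟨K, hK, hKU, hK0⟩ := hf.2
  obtain ⟨ψ, h1, h2, h3⟩ := hsub K hK hKU
  have : extByZero U f = extByZero U (ψ * f) := by
    funext y
    by_cases hy : y ∈ U
    · rw [extByZero_of_mem hy, extByZero_of_mem hy, Germ.coe_eq]
      filter_upwards [hU.mem_nhds hy] with z hz
      by_cases hzK : z ∈ K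
      · simp [h2 z hzK]
      · simp [hK0 z hz hzK]
    · rw [extByZero_of_notMem hy, extByZero_of_notMem hy]
  rw [this]
  exact h3 f hf

theorem Cc.mem_pieces {E : Shf n M} {u : Sections 𝕜 E} (hu : u ∈ Cc 𝕜 E) : u ∈ pieces 𝕜 E := by
  change u ∈ AddSubgroup.closure (generators 𝕜 E) at hu
  rw [← AddSubgroup.mem_toAddSubmonoid, AddSubgroup.closure_toAddSubmonoid] at hu
  refine AddSubmonoid.closure_le.2 ?_ hu
  rintro u (⟨U, f, hU, hT, hf, rfl⟩ | ⟨U, f, hU, hT, hf, hu⟩)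
  · exact extByZero_mem_pieces hU hT hf
  · rw [← neg_neg u, hu, ← extByZero_neg]
    exact extByZero_mem_pieces hU hT hf.neg

/-- Every element of `C_c^∞(E)` is a sum of functions of the form `f ∘ π|_U`. -/
theorem Cc.induction {E : Shf n M} {p : Cc 𝕜 E → Prop} (hz : p 0)
    (hp : ∀ U f h, p (Cc.piece U f h)) (ha : ∀ u v, p u → p v → p (u + v)) (u : Cc 𝕜 E) : p u := by
  have key : ∀ v ∈ pieces 𝕜 E, ∃ h : v ∈ Cc 𝕜 E, p ⟨v, h⟩ := by
    intro v hv
    induction hv using AddSubmonoid.closure_induction with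
    | mem v hv => obtain ⟨U, f, h, rfl⟩ := hv; exact ⟨_, hp U f h⟩
    | zero => exact ⟨zero_mem _, hz⟩
    | add v w _ _ hv hw => exact ⟨add_mem hv.1 hw.1, ha _ _ hv.2 hw.2⟩
  exact (key u.1 (Cc.mem_pieces u.2)).2

theorem Cc.piece_congr {E : Shf n M} {U V : Set E} {f g : Rc 𝕜 n M} (hU : U = V) (hf : f = g)
    (h : Adapted U f) : Cc.piece U f h = Cc.piece V g (hU ▸ hf ▸ h) := by
  subst hU; subst hf; rfl

theorem Cc.act_piece {E : Shf n M} {U : Set E} {f : Rc 𝕜 n M} (h : Adapted U f) (r : Rc 𝕜 n M) :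
    act r (Cc.piece U f h) = Cc.piece U (r * f) (h.mul r) :=
  Subtype.ext (act_extByZero r U _)

end Sections

/-! ### Functoriality of smooth functions with compact support -/

section Pushforward

variable {𝕜 : Type} [RCLike 𝕜] {n : ℕ} {M : Type u} [TopologicalSpace M]
  [ChartedSpace (EuclideanSpace ℝ (Fin n)) M] [IsManifold (𝓡 n) ∞ M]

theorem Uz.map_smul_of_act {R : Type u} [NonUnitalCommRing R] {C D : Type*} [AddCommGroup C]
    [Module (Uz R) C] [AddCommGroup D] [Module (Uz R) D] (f : C →+ D)
    (h : ∀ (r : R) (c : C), f (act r c) = act r (f c)) (a : Uz R) (c : C) : f (a • c) = a • f c := by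
  induction a using Uz.induction with
  | h1 m => rw [Int.cast_smul_eq_zsmul, Int.cast_smul_eq_zsmul, map_zsmul]
  | h2 r => exact h r c
  | h3 a b ha hb => rw [add_smul, add_smul, map_add, ha, hb]

/-- The pullback `φ^*` of germs along a continuous map. -/
def germPull {X Y : Type u} [TopologicalSpace X] [TopologicalSpace Y] (φ : X → Y)
    (hφ : Continuous φ) {y : X} {z : Y} (h : φ y = z) : Germ (𝓝 z) 𝕜 →+* Germ (𝓝 y) 𝕜 where
  toFun g := g.compTendsto φ (h ▸ hφ.continuousAt)
  map_one' := rfl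
  map_zero' := rfl
  map_add' g k := by
    induction g, k using Germ.inductionOn₂; rfl
  map_mul' g k := by
    induction g, k using Germ.inductionOn₂; rfl

theorem germPull_coe {X Y : Type u} [TopologicalSpace X] [TopologicalSpace Y] (φ : X → Y)
    (hφ : Continuous φ) {y : X} {z : Y} (h : φ y = z) (f : Y → 𝕜) :
    germPull φ hφ h (f : Germ (𝓝 z) 𝕜) = ((f ∘ φ : X → 𝕜) : Germ (𝓝 y) 𝕜) := rfl

theorem germPull_bijective {X Y : Type u} [TopologicalSpace X] [TopologicalSpace Y] (φ : X → Y)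
    (hφ : IsLocalHomeomorph φ) {y : X} {z : Y} (h : φ y = z) :
    Function.Bijective (germPull (𝕜 := 𝕜) φ hφ.continuous h) := by
  subst h
  constructor
  · intro g k
    induction g, k using Germ.inductionOn₂ with | _ g k
    intro hgk
    rw [germPull_coe, germPull_coe, Germ.coe_eq] at hgk
    rw [Germ.coe_eq, EventuallyEq, ← hφ.map_nhds_eq]
    exact eventually_map.2 hgk
  · intro g
    induction g using Germ.inductionOn with | _ g
    refine ⟨((g ∘ (hφ y).choose.symm : Y → 𝕜) : Germ (𝓝 (φ y)) 𝕜), ?_⟩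
    rw [germPull_coe, Germ.coe_eq]
    filter_upwards [(hφ y).choose.open_source.mem_nhds (hφ y).choose_spec.1] with w hw
    have h1 := (hφ y).choose.left_inv hw
    have h2 : φ w = (hφ y).choose w := congrFun (hφ y).choose_spec.2 w
    simp only [Function.comp_apply, h2]
    rw [h1]

/-- The isomorphism `φ_y^*` of germs, for a local homeomorphism `φ`. -/
def germEquiv {X Y : Type u} [TopologicalSpace X] [TopologicalSpace Y] (φ : X → Y)
    (hφ : IsLocalHomeomorph φ) {y : X} {z : Y} (h : φ y = z) : Germ (𝓝 z) 𝕜 ≃+* Germ (𝓝 y) 𝕜 :=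
  RingEquiv.ofBijective _ (germPull_bijective φ hφ h)

theorem germEquiv_symm_coe {X Y : Type u} [TopologicalSpace X] [TopologicalSpace Y] (φ : X → Y)
    (hφ : IsLocalHomeomorph φ) {y : X} {z : Y} (h : φ y = z) (f : Y → 𝕜) :
    (germEquiv φ hφ h).symm ((f ∘ φ : X → 𝕜) : Germ (𝓝 y) 𝕜) = (f : Germ (𝓝 z) 𝕜) :=
  (RingEquiv.symm_apply_eq _).2 rfl

/-- `φ_+(u)_z = ∑ φ_{*y}(u_y)`, the sum over the points `y` with `φ(y) = z`, where `φ_{*y}` is the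
inverse of `φ_y^*`. -/
def pushFun {E F : Shf n M} (φ : E ⟶ F) (u : Sections 𝕜 E) : Sections 𝕜 F :=
  fun z => ∑ᶠ y : φ.toFun ⁻¹' {z}, (germEquiv φ.toFun φ.homeo y.2).symm (u y.1)

theorem pushFun_zero {E F : Shf n M} (φ : E ⟶ F) : pushFun φ (0 : Sections 𝕜 E) = 0 := by
  funext z
  exact finsum_eq_zero_of_forall_eq_zero fun y => map_zero _

theorem pushFun_extByZero {E F : Shf n M} (φ : E ⟶ F) {U : Set E} (hU : Set.InjOn φ.toFun U)
    (f : M → 𝕜) : pushFun φ (extByZero U (f ∘ E.proj)) = extByZero (φ.toFun '' U) (f ∘ F.proj) := by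
  funext z
  have hf : f ∘ E.proj = (f ∘ F.proj) ∘ φ.toFun := funext fun y => by simp [φ.proj_comp]
  by_cases hz : z ∈ φ.toFun '' U
  · rw [extByZero_of_mem hz]
    obtain ⟨y, hy, hyz⟩ := hz
    rw [pushFun, finsum_eq_single _ ⟨y, hyz⟩, extByZero_of_mem hy, hf]
    · exact germEquiv_symm_coe φ.toFun φ.homeo hyz _
    rintro ⟨w, hw⟩ hne
    have : w ∉ U := fun h => hne (Subtype.ext (hU h hy (hw.trans hyz.symm)))
    rw [extByZero_of_notMem this, map_zero]
  · rw [extByZero_of_notMem hz]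
    refine finsum_eq_zero_of_forall_eq_zero fun y => ?_
    rw [extByZero_of_notMem fun h => hz ⟨y.1, h, y.2⟩, map_zero]

theorem Shf.Elementary.injOn {E F : Shf n M} (φ : E ⟶ F) {U : Set E} (hU : E.Elementary U) :
    Set.InjOn φ.toFun U := fun y hy z hz h => hU.2 hy hz (by
  rw [← φ.proj_comp, ← φ.proj_comp, h])

theorem Shf.Elementary.image {E F : Shf n M} (φ : E ⟶ F) {U : Set E} (hU : E.Elementary U) :
    F.Elementary (φ.toFun '' U) := by
  refine ⟨φ.homeo.isOpenMap U hU.1, ?_⟩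
  rintro _ ⟨y, hy, rfl⟩ _ ⟨z, hz, rfl⟩ h
  rw [φ.proj_comp, φ.proj_comp] at h
  rw [hU.2 hy hz h]

theorem Adapted.image {E F : Shf n M} (φ : E ⟶ F) {U : Set E} {f : Rc 𝕜 n M} (h : Adapted U f) :
    Adapted (φ.toFun '' U) f := by
  refine ⟨h.elementary.image φ, fun x hx => ?_⟩
  obtain ⟨y, hy, rfl⟩ := h.supp hx
  exact ⟨_, ⟨y, hy, rfl⟩, φ.proj_comp y⟩

variable [T2Space M]

theorem Cc.finite_support {E F : Shf n M} (φ : E ⟶ F) (u : Cc 𝕜 E) (z : F) :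
    (Function.support fun y : φ.toFun ⁻¹' {z} =>
      (germEquiv φ.toFun φ.homeo y.2).symm (u.1 y.1)).Finite := by
  induction u using Cc.induction with
  | hz =>
    refine Set.finite_empty.subset fun y hy => hy ?_
    exact map_zero _
  | hp U f h =>
    refine Set.Subsingleton.finite ?_
    have key : ∀ y : φ.toFun ⁻¹' {z}, (germEquiv φ.toFun φ.homeo y.2).symm
        ((Cc.piece U f h).1 y.1) ≠ 0 → y.1 ∈ U := fun y hy => by
      by_contra hyU
      refine hy ?_
      change (germEquiv φ.toFun φ.homeo y.2).symm (extByZero U (f.1 ∘ E.proj) y.1) = 0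
      rw [extByZero_of_notMem hyU, map_zero]
    intro y hy w hw
    exact Subtype.ext (h.elementary.injOn φ (key y hy) (key w hw) (y.2.trans w.2.symm))
  | ha u v hu hv =>
    refine (hu.union hv).subset fun y hy => ?_
    by_contra h
    simp only [Set.mem_union, Function.mem_support, not_or, not_not] at h
    refine hy ?_
    change (germEquiv φ.toFun φ.homeo y.2).symm (u.1 y.1 + v.1 y.1) = 0
    rw [map_add, h.1, h.2, add_zero]

theorem pushFun_add {E F : Shf n M} (φ : E ⟶ F) (u v : Cc 𝕜 E) :
    pushFun φ (u + v).1 = pushFun φ u.1 + pushFun φ v.1 := by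
  funext z
  refine Eq.trans ?_ (finsum_add_distrib (Cc.finite_support φ u z) (Cc.finite_support φ v z))
  exact finsum_congr fun y => map_add _ _ _

theorem pushFun_mem {E F : Shf n M} (φ : E ⟶ F) (u : Cc 𝕜 E) : pushFun φ u.1 ∈ Cc 𝕜 F := by
  induction u using Cc.induction with
  | hz => rw [Submodule.coe_zero, pushFun_zero]; exact zero_mem _
  | hp U f h =>
    have := pushFun_extByZero φ (h.elementary.injOn φ) f.1
    exact this ▸ (Cc.piece _ f (h.image φ)).2
  | ha u v hu hv => rw [pushFun_add]; exact add_mem hu hv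

/-- `φ_+` as an additive map. -/
def Cc.pushAdd {E F : Shf n M} (φ : E ⟶ F) : Cc 𝕜 E →+ Cc 𝕜 F where
  toFun u := ⟨pushFun φ u.1, pushFun_mem φ u⟩
  map_zero' := Subtype.ext (pushFun_zero φ)
  map_add' u v := Subtype.ext (pushFun_add φ u v)

theorem Cc.pushAdd_piece {E F : Shf n M} (φ : E ⟶ F) {U : Set E} {f : Rc 𝕜 n M}
    (h : Adapted U f) : Cc.pushAdd φ (Cc.piece U f h) = Cc.piece _ f (h.image φ) :=
  Subtype.ext (pushFun_extByZero φ (h.elementary.injOn φ) f.1)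

/-- `φ_+ : C_c^∞(E) → C_c^∞(F)`. -/
def Cc.push {E F : Shf n M} (φ : E ⟶ F) : Cc 𝕜 E →ₗ[Uz (Rc 𝕜 n M)] Cc 𝕜 F where
  __ := Cc.pushAdd φ
  map_smul' := Uz.map_smul_of_act (Cc.pushAdd φ) fun r u => by
    induction u using Cc.induction with
    | hz => simp
    | hp U f h => rw [Cc.act_piece, Cc.pushAdd_piece, Cc.pushAdd_piece, Cc.act_piece]
    | ha u v hu hv => rw [act_add, map_add, map_add, act_add, hu, hv]

theorem Cc.push_piece {E F : Shf n M} (φ : E ⟶ F) {U : Set E} {f : Rc 𝕜 n M}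
    (h : Adapted U f) : Cc.push φ (Cc.piece U f h) = Cc.piece _ f (h.image φ) :=
  Cc.pushAdd_piece φ h

/-! ### The counit -/

theorem Cc.value_piece {U : Set (Shf.base n M)} {f : Rc 𝕜 n M} (h : Adapted U f) (x : M) :
    Germ.value ((Cc.piece U f h).1 x) = f x := by
  by_cases hx : x ∈ U
  · exact congrArg Germ.value (extByZero_of_mem (E := Shf.base n M) hx)
  · refine (congrArg Germ.value (extByZero_of_notMem (E := Shf.base n M) hx)).trans ?_
    have : x ∉ tsupport f.1 := fun hx' => hx (by
      obtain ⟨y, hy, rfl⟩ := h.supp hx'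
      exact hy)
    exact (image_eq_zero_of_notMem_tsupport this).symm

theorem Cc.value_mem (u : Cc 𝕜 (Shf.base n M)) :
    (fun x : M => Germ.value (u.1 x)) ∈ smoothCompact 𝕜 n M := by
  induction u using Cc.induction with
  | hz => exact zero_mem _
  | hp U f h =>
    have : (fun x : M => Germ.value ((Cc.piece U f h).1 x)) = f.1 :=
      funext fun x => Cc.value_piece h x
    rw [this]; exact f.2
  | ha u v hu hv =>
    have : (fun x : M => Germ.value ((u + v).1 x)) =
      (fun x : M => Germ.value (u.1 x)) + fun x : M => Germ.value (v.1 x) :=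
      funext fun x => map_add Germ.valueAddHom (u.1 x) (v.1 x)
    rw [this]; exact add_mem hu hv

/-- The identification of sections of germs on the Hausdorff manifold `M` with functions. -/
def Cc.ofBaseAdd : Cc 𝕜 (Shf.base n M) →+ Rc 𝕜 n M where
  toFun u := ⟨fun x => Germ.value (u.1 x), Cc.value_mem u⟩
  map_zero' := rfl
  map_add' u v := Rc.ext fun x => map_add Germ.valueAddHom (u.1 x) (v.1 x)

/-- The identification of sections of germs on the Hausdorff manifold `M` with functions. -/
def Cc.ofBase : Cc 𝕜 (Shf.base n M) →ₗ[Uz (Rc 𝕜 n M)] Rc 𝕜 n M where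
  __ := Cc.ofBaseAdd
  map_smul' := Uz.map_smul_of_act Cc.ofBaseAdd fun r u => by
    refine Rc.ext fun x => ?_
    rw [selfModule_act]
    exact (congrArg Germ.value (act_apply (E := Shf.base n M) r u.1 x)).trans
      (map_mul Germ.valueMulHom _ (u.1 x))

/-- The counit `π_+`. -/
def Cc.counit (E : Shf n M) : Cc 𝕜 E →ₗ[Uz (Rc 𝕜 n M)] Rc 𝕜 n M :=
  Cc.ofBase ∘ₗ Cc.push E.projHom

theorem Cc.counit_piece {E : Shf n M} {U : Set E} {f : Rc 𝕜 n M} (h : Adapted U f) :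
    Cc.counit E (Cc.piece U f h) = f := by
  refine Rc.ext fun x => ?_
  rw [Cc.counit, LinearMap.comp_apply, Cc.push_piece]
  exact Cc.value_piece _ x

/-! ### The comultiplication -/

/-- The projection `E ×_M F → E`. -/
def Shf.fst (E F : Shf n M) : E.fiberProd F ⟶ E :=
  Shf.homMk (E := E.fiberProd F) (fun p => p.1.1)
    (continuous_fst.comp continuous_subtype_val) fun _ => rfl

/-- The projection `E ×_M F → F`. -/
def Shf.snd (E F : Shf n M) : E.fiberProd F ⟶ F :=
  Shf.homMk (E := E.fiberProd F) (fun p => p.1.2)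
    (continuous_snd.comp continuous_subtype_val) fun p => p.2.symm

/-- `Ω(u ⊗ v)_{(y,z)}` is the product of the pullbacks of `u_y` and `v_z`. -/
def omegaFun {E F : Shf n M} (u : Sections 𝕜 E) (v : Sections 𝕜 F) :
    Sections 𝕜 (E.fiberProd F) := fun p =>
  germEquiv (Shf.fst E F).toFun (Shf.fst E F).homeo rfl (u ((Shf.fst E F).toFun p)) *
    germEquiv (Shf.snd E F).toFun (Shf.snd E F).homeo rfl (v ((Shf.snd E F).toFun p))

theorem omegaFun_add_left {E F : Shf n M} (u u' : Sections 𝕜 E) (v : Sections 𝕜 F) :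
    omegaFun (u + u') v = omegaFun u v + omegaFun u' v := by
  funext p
  exact (congrArg (· * _) (map_add _ _ _)).trans (add_mul _ _ _)

theorem omegaFun_add_right {E F : Shf n M} (u : Sections 𝕜 E) (v v' : Sections 𝕜 F) :
    omegaFun u (v + v') = omegaFun u v + omegaFun u v' := by
  funext p
  exact (congrArg (_ * ·) (map_add _ _ _)).trans (mul_add _ _ _)

theorem omegaFun_act_left {E F : Shf n M} (r : Rc 𝕜 n M) (u : Sections 𝕜 E) (v : Sections 𝕜 F) :
    omegaFun (act r u) v = act r (omegaFun u v) := by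
  funext p
  rw [act_apply, omegaFun, act_apply, map_mul, mul_assoc]
  rfl

theorem omegaFun_act_right {E F : Shf n M} (r : Rc 𝕜 n M) (u : Sections 𝕜 E) (v : Sections 𝕜 F) :
    omegaFun u (act r v) = act r (omegaFun u v) := by
  funext p
  rw [act_apply, omegaFun, act_apply, map_mul, mul_left_comm]
  refine congrArg₂ _ ?_ rfl
  have : (E.fiberProd F).proj = F.proj ∘ (Shf.snd E F).toFun :=
    (funext (Shf.snd E F).proj_comp).symm
  rw [this]; rfl

/-- `U ×_M V`. -/
def prodSet {E F : Shf n M} (U : Set E) (V : Set F) : Set (E.fiberProd F) :=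
  (Shf.fst E F).toFun ⁻¹' U ∩ (Shf.snd E F).toFun ⁻¹' V

theorem omegaFun_extByZero {E F : Shf n M} (U : Set E) (V : Set F) (f g : M → 𝕜) :
    omegaFun (extByZero U (f ∘ E.proj)) (extByZero V (g ∘ F.proj)) =
      extByZero (prodSet U V) ((f * g) ∘ (E.fiberProd F).proj) := by
  funext p
  rw [omegaFun]
  by_cases h1 : (Shf.fst E F).toFun p ∈ U
  · by_cases h2 : (Shf.snd E F).toFun p ∈ V
    · have h3 : p ∈ prodSet U V := ⟨h1, h2⟩
      rw [extByZero_of_mem h1, extByZero_of_mem h2, extByZero_of_mem h3]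
      have e1 : (E.fiberProd F).proj = F.proj ∘ (Shf.snd E F).toFun :=
        (funext (Shf.snd E F).proj_comp).symm
      have e2 : ((f * g) ∘ (E.fiberProd F).proj) =
        ((f ∘ E.proj) ∘ (Shf.fst E F).toFun) * ((g ∘ F.proj) ∘ (Shf.snd E F).toFun) := by
        rw [Function.comp_assoc g, ← e1]; rfl
      rw [e2]; rfl
    · have h3 : p ∉ prodSet U V := fun h => h2 h.2
      rw [extByZero_of_notMem h2, map_zero, mul_zero, extByZero_of_notMem h3]
  · have h3 : p ∉ prodSet U V := fun h => h1 h.1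
    rw [extByZero_of_notMem h1, map_zero, zero_mul, extByZero_of_notMem h3]

theorem Adapted.prod {E F : Shf n M} {U : Set E} {V : Set F} {f g : Rc 𝕜 n M}
    (h : Adapted U f) (h' : Adapted V g) : Adapted (prodSet U V) (f * g) := by
  refine ⟨⟨(h.elementary.1.preimage (Shf.fst E F).smooth.continuous).inter
    (h'.elementary.1.preimage (Shf.snd E F).smooth.continuous), ?_⟩, fun x hx => ?_⟩
  · intro p hp q hq hpq
    have e1 : (Shf.fst E F).toFun p = (Shf.fst E F).toFun q :=
      h.elementary.2 hp.1 hq.1 (by rw [(Shf.fst E F).proj_comp, (Shf.fst E F).proj_comp, hpq])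
    have e2 : (Shf.snd E F).toFun p = (Shf.snd E F).toFun q :=
      h'.elementary.2 hp.2 hq.2 (by rw [(Shf.snd E F).proj_comp, (Shf.snd E F).proj_comp, hpq])
    exact Subtype.ext (Prod.ext e1 e2)
  · have h1 : x ∈ tsupport f.1 := closure_mono
      (show Function.support (f * g).1 ⊆ Function.support f.1 from
        fun y hy h0 => hy (show f y * g y = 0 by rw [show f y = 0 from h0, zero_mul])) hx
    have h2 : x ∈ tsupport g.1 := closure_mono
      (show Function.support (f * g).1 ⊆ Function.support g.1 from
        fun y hy h0 => hy (show f y * g y = 0 by rw [show g y = 0 from h0, mul_zero])) hx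
    obtain ⟨y, hy, hyx⟩ := h.supp h1
    obtain ⟨z, hz, hzx⟩ := h'.supp h2
    exact ⟨⟨(y, z), hyx.trans hzx.symm⟩, ⟨hy, hz⟩, hyx⟩

theorem omegaFun_mem {E F : Shf n M} (u : Cc 𝕜 E) (v : Cc 𝕜 F) :
    omegaFun u.1 v.1 ∈ Cc 𝕜 (E.fiberProd F) := by
  induction u using Cc.induction with
  | hz =>
    have : omegaFun (0 : Sections 𝕜 E) v.1 = 0 := by
      funext p; rw [omegaFun]; exact (congrArg (· * _) (map_zero _)).trans (zero_mul _)
    exact this ▸ zero_mem _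
  | hp U f h =>
    induction v using Cc.induction with
    | hz =>
      have : omegaFun (Cc.piece U f h).1 (0 : Sections 𝕜 F) = 0 := by
        funext p; rw [omegaFun]; exact (congrArg (_ * ·) (map_zero _)).trans (mul_zero _)
      exact this ▸ zero_mem _
    | hp V g h' =>
      have := omegaFun_extByZero (E := E) (F := F) U V f.1 g.1
      exact this ▸ (Cc.piece _ (f * g) (h.prod h')).2
    | ha v w hv hw =>
      exact (omegaFun_add_right _ v.1 w.1) ▸ add_mem hv hw
  | ha u w hu hw => exact (omegaFun_add_left u.1 w.1 v.1) ▸ add_mem hu hw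

/-- The natural map `Ω : C_c^∞(E) ⊗ C_c^∞(F) → C_c^∞(E ×_M F)`. -/
def omega (E F : Shf n M) :
    Cc 𝕜 E ⊗[Uz (Rc 𝕜 n M)] Cc 𝕜 F →ₗ[Uz (Rc 𝕜 n M)] Cc 𝕜 (E.fiberProd F) :=
  TensorProduct.lift (LinearMap.mk₂ _ (fun u v => ⟨omegaFun u.1 v.1, omegaFun_mem u v⟩)
    (fun u u' v => Subtype.ext (omegaFun_add_left _ _ _))
    (fun a u v => Uz.map_smul_of_act (C := Cc 𝕜 E) (D := Cc 𝕜 (E.fiberProd F))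
      (AddMonoidHom.mk' (fun u : Cc 𝕜 E => ⟨omegaFun u.1 v.1, omegaFun_mem u v⟩)
        fun u u' => Subtype.ext (omegaFun_add_left _ _ _))
      (fun r u => Subtype.ext (omegaFun_act_left r u.1 v.1)) a u)
    (fun u v v' => Subtype.ext (omegaFun_add_right _ _ _))
    (fun a u v => Uz.map_smul_of_act (C := Cc 𝕜 F) (D := Cc 𝕜 (E.fiberProd F))
      (AddMonoidHom.mk' (fun v : Cc 𝕜 F => ⟨omegaFun u.1 v.1, omegaFun_mem u v⟩)
        fun v v' => Subtype.ext (omegaFun_add_right _ _ _))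
      (fun r v => Subtype.ext (omegaFun_act_right r u.1 v.1)) a v))

theorem omega_tmul {E F : Shf n M} (u : Cc 𝕜 E) (v : Cc 𝕜 F) :
    (omega E F (u ⊗ₜ v)).1 = omegaFun u.1 v.1 := rfl

theorem omega_piece {E F : Shf n M} {U : Set E} {V : Set F} {f g : Rc 𝕜 n M}
    (h : Adapted U f) (h' : Adapted V g) :
    omega E F (Cc.piece U f h ⊗ₜ Cc.piece V g h') = Cc.piece _ (f * g) (h.prod h') :=
  Subtype.ext (omegaFun_extByZero U V f.1 g.1)

theorem Rc.mul_eq_of_oneAt {f η : Rc 𝕜 n M} (h : ∀ x ∈ tsupport f.1, OneAt η x) : η * f = f := by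
  refine Rc.ext fun x => ?_
  by_cases hx : x ∈ tsupport f.1
  · have : η x = 1 := (h x hx).self_of_nhds
    simp [this]
  · have : f x = 0 := image_eq_zero_of_notMem_tsupport hx
    simp [this]

theorem Adapted.exists_eta {E : Shf n M} {U : Set E} {f : Rc 𝕜 n M} (h : Adapted U f) :
    ∃ η : Rc 𝕜 n M, Adapted U η ∧ η * f = f := by
  obtain ⟨η, h1, h2⟩ := exists_one_on_compact (𝕜 := 𝕜) (n := n) f.2.2.isCompact
    (E.homeo.isOpenMap U h.elementary.1) h.supp
  exact ⟨η, ⟨h.elementary, h2⟩, Rc.mul_eq_of_oneAt h1⟩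

theorem omega_surjective (E F : Shf n M) : Function.Surjective (omega (𝕜 := 𝕜) E F) := by
  intro w
  induction w using Cc.induction with
  | hz => exact ⟨0, map_zero _⟩
  | hp W f h =>
    have h1 : Adapted ((Shf.fst E F).toFun '' W) f := h.image _
    have h2 : Adapted ((Shf.snd E F).toFun '' W) f := h.image _
    obtain ⟨η, h3, h4⟩ := h2.exists_eta
    refine ⟨Cc.piece _ f h1 ⊗ₜ Cc.piece _ η h3, ?_⟩
    rw [omega_piece]
    refine Subtype.ext ?_
    have e1 : prodSet ((Shf.fst E F).toFun '' W) ((Shf.snd E F).toFun '' W) = W := by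
      ext p
      refine ⟨?_, fun hp => ⟨⟨p, hp, rfl⟩, ⟨p, hp, rfl⟩⟩⟩
      rintro ⟨⟨q, hq, hqp⟩, ⟨q', hq', hqp'⟩⟩
      have e : q = q' := h.elementary.2 hq hq' (by
        rw [← (Shf.fst E F).proj_comp, ← (Shf.snd E F).proj_comp q', hqp, hqp',
          (Shf.fst E F).proj_comp, (Shf.snd E F).proj_comp])
      subst e
      have : p = q := Subtype.ext (Prod.ext hqp.symm hqp'.symm)
      rwa [this]
    change extByZero (prodSet _ _) _ = extByZero W _
    rw [e1, mul_comm, h4]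
  | ha u v hu hv =>
    obtain ⟨s, rfl⟩ := hu
    obtain ⟨t, rfl⟩ := hv
    exact ⟨s + t, map_add _ _ _⟩

end Pushforward

/-! ### The coalgebra of smooth functions with compact support -/

section CoalgebraOfSheaf

variable {𝕜 : Type} [RCLike 𝕜] {n : ℕ} {M : Type u} [TopologicalSpace M]
  [ChartedSpace (EuclideanSpace ℝ (Fin n)) M] [IsManifold (𝓡 n) ∞ M] [T2Space M]

section Local

variable {C : Type*} [AddCommGroup C] [Module (Uz (Rc 𝕜 n M)) C]

theorem Loc.mk_eq_of_act {x : M} {c d : C} {g : Rc 𝕜 n M} (hg : OneAt g x)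
    (h : act g c = act g d) : Loc.mk 𝕜 n x c = Loc.mk 𝕜 n x d :=
  (Submodule.Quotient.eq _).2 ⟨g, hg, by rw [act_sub, h, sub_self]⟩

/-- The functions of `R` which equal `1` near some compact set act as the identity on `c`. -/
def CompactlyUnitary (c : C) : Prop :=
  ∃ K : Set M, IsCompact K ∧ ∀ r : Rc 𝕜 n M, (∀ x ∈ K, OneAt r x) → act r c = c

theorem CompactlyUnitary.add {c d : C} (hc : CompactlyUnitary (𝕜 := 𝕜) (n := n) (M := M) c)
    (hd : CompactlyUnitary (𝕜 := 𝕜) (n := n) (M := M) d) :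
    CompactlyUnitary (𝕜 := 𝕜) (n := n) (M := M) (c + d) := by
  obtain ⟨K, hK, h1⟩ := hc
  obtain ⟨L, hL, h2⟩ := hd
  refine ⟨K ∪ L, hK.union hL, fun r hr => ?_⟩
  rw [act_add, h1 r fun x hx => hr x (Or.inl hx), h2 r fun x hx => hr x (Or.inr hx)]

theorem eq_zero_of_forall_nullAt {c : C} (h1 : CompactlyUnitary (𝕜 := 𝕜) (n := n) (M := M) c)
    (h : ∀ x : M, c ∈ nullAt 𝕜 n x C) : c = 0 := by
  obtain ⟨K, hK, hr⟩ := h1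
  obtain ⟨r, hr1, -⟩ := exists_one_on_compact (𝕜 := 𝕜) (n := n) hK isOpen_univ (Set.subset_univ _)
  obtain ⟨ψ, hψ1, hψ2⟩ : ∃ ψ : Rc 𝕜 n M, (∀ x ∈ tsupport r.1, OneAt ψ x) ∧ act ψ c = 0 := by
    refine r.2.2.isCompact.induction_on
      (p := fun K => ∃ ψ : Rc 𝕜 n M, (∀ x ∈ K, OneAt ψ x) ∧ act ψ c = 0)
      ⟨0, by simp, by rw [act, map_zero, zero_smul]⟩
      (fun s t hst h => h.imp fun r hr => ⟨fun x hx => hr.1 x (hst hx), hr.2⟩) ?_ ?_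
    · rintro s t ⟨r, hr, hr'⟩ ⟨q, hq, hq'⟩
      refine ⟨r + q - r * q, ?_, ?_⟩
      · rintro x (hx | hx)
        · filter_upwards [hr x hx] with y hy
          simp [hy]
        · filter_upwards [hq x hx] with y hy
          simp [hy]
      · have : act (r + q - r * q) c = act r c + act q c - act r (act q c) := by
          rw [← act_mul]; simp only [act, map_sub, map_add, sub_smul, add_smul]
        rw [this, hr', hq']; simp
    · intro x _
      obtain ⟨g, hg, hc⟩ := h x
      exact ⟨_, mem_nhdsWithin_of_mem_nhds (eventually_eventually_nhds.2 hg), g, fun y hy => hy, hc⟩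
  rw [← hr r hr1, ← Rc.mul_eq_of_oneAt hψ1, mul_comm, act_mul, hψ2, act_zero]

theorem Loc.mk_act_eq_zero {x : M} {r : Rc 𝕜 n M} (hr : r.1 =ᶠ[𝓝 x] 0) (c : C) :
    Loc.mk 𝕜 n x (act r c) = 0 := by
  obtain ⟨g, hg, hgr⟩ := exists_bump (𝕜 := 𝕜) (n := n) x (eventually_eventually_nhds.2 hr)
  refine (Submodule.Quotient.mk_eq_zero _).2 ⟨g, hg, ?_⟩
  have : g * r = 0 := by
    refine Rc.ext fun y => ?_
    by_cases hy : g y = 0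
    · simp [hy]
    · have h1 : r y = 0 := (hgr (subset_tsupport g.1 hy)).self_of_nhds
      simp [h1]
  rw [← act_mul, this, act, map_zero, zero_smul]

end Local

theorem Cc.compactlyUnitary {E : Shf n M} (u : Cc 𝕜 E) :
    CompactlyUnitary (𝕜 := 𝕜) (n := n) (M := M) u := by
  induction u using Cc.induction with
  | hz => exact ⟨∅, isCompact_empty, fun r _ => act_zero r⟩
  | hp U f h =>
    refine ⟨tsupport f.1, f.2.2, fun r hr => ?_⟩
    rw [Cc.act_piece]
    exact (Cc.piece_congr rfl (Rc.mul_eq_of_oneAt hr).symm h).symm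
  | ha u v hu hv => exact hu.add hv

theorem Cc.tensor_compactlyUnitary {E : Shf n M} (t : Cc 𝕜 E ⊗[Uz (Rc 𝕜 n M)] Cc 𝕜 E) :
    CompactlyUnitary (𝕜 := 𝕜) (n := n) (M := M) t := by
  induction t using TensorProduct.induction_on with
  | zero => exact ⟨∅, isCompact_empty, fun r _ => act_zero r⟩
  | tmul u v =>
    obtain ⟨K, hK, h⟩ := Cc.compactlyUnitary u
    exact ⟨K, hK, fun r hr => by rw [act_tmul, h r hr]⟩
  | add s t hs ht => exact hs.add ht

theorem Cc.locallyUnitary {E : Shf n M} (s : Finset (Cc 𝕜 E)) :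
    ∃ r : Rc 𝕜 n M, ∀ u ∈ s, act r u = u := by
  choose K hK h using fun u : Cc 𝕜 E => Cc.compactlyUnitary u
  obtain ⟨r, hr, -⟩ := exists_one_on_compact (𝕜 := 𝕜) (n := n)
    (s.isCompact_biUnion fun u _ => hK u) isOpen_univ (Set.subset_univ _)
  exact ⟨r, fun u hu => h u r fun x hx => hr x (Set.mem_biUnion (x := u) hu hx)⟩

theorem Cc.piece_shrink {E : Shf n M} {U V : Set E} {f : Rc 𝕜 n M} (h : Adapted U f)
    (h' : Adapted V f) (hVU : V ⊆ U) : Cc.piece U f h = Cc.piece V f h' := by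
  refine Subtype.ext (funext fun w => ?_)
  change extByZero U _ w = extByZero V _ w
  by_cases hV : w ∈ V
  · rw [extByZero_of_mem hV, extByZero_of_mem (hVU hV)]
  rw [extByZero_of_notMem hV]
  by_cases hU : w ∈ U
  · rw [extByZero_of_mem hU]
    have : E.proj w ∉ tsupport f.1 := fun hw => by
      obtain ⟨v, hv, hvw⟩ := h'.supp hw
      rw [h.elementary.2 (hVU hv) hU hvw] at hv
      exact hV hv
    refine (Germ.coe_eq (f := f.1 ∘ E.proj) (g := 0)).2 ?_
    exact E.homeo.continuous.continuousAt.eventually (notMem_tsupport_iff_eventuallyEq.1 this)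
  · rw [extByZero_of_notMem hU]

theorem Cc.exists_unit (E : Shf n M) (y : E) :
    ∃ (U : Set E) (b : Rc 𝕜 n M), Adapted U b ∧ y ∈ U ∧ OneAt b (E.proj y) := by
  obtain ⟨U, hU, hy, -⟩ := E.exists_elementary y univ_mem
  obtain ⟨b, hb, hbU⟩ := exists_bump (𝕜 := 𝕜) (n := n) (E.proj y)
    ((E.homeo.isOpenMap U hU.1).mem_nhds ⟨y, hy, rfl⟩)
  exact ⟨U, b, ⟨hU, hbU⟩, hy, hb⟩

theorem Cc.mk_piece_eq {E : Shf n M} {U V : Set E} {f b : Rc 𝕜 n M} (h : Adapted U f)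
    (h' : Adapted V b) {y : E} (hU : y ∈ U) (hV : y ∈ V) (hb : OneAt b (E.proj y)) :
    Loc.mk 𝕜 n (E.proj y) (Cc.piece U f h) = Loc.mk 𝕜 n (E.proj y) (act f (Cc.piece V b h')) := by
  have hUV : IsOpen (U ∩ V) := h.elementary.1.inter h'.elementary.1
  obtain ⟨g, hg, hgs⟩ := exists_bump (𝕜 := 𝕜) (n := n) (E.proj y) (inter_mem
    (eventually_eventually_nhds.2 hb) ((E.homeo.isOpenMap _ hUV).mem_nhds ⟨y, ⟨hU, hV⟩, rfl⟩))
  refine Loc.mk_eq_of_act hg ?_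
  rw [← act_mul, Cc.act_piece, Cc.act_piece]
  have e : g * f * b = g * f := by
    have : b * g = g := Rc.mul_eq_of_oneAt fun x hx => (hgs hx).1
    rw [mul_assoc, mul_comm f b, ← mul_assoc, mul_comm g b, this]
  have hs : tsupport (g * f).1 ⊆ tsupport g.1 := closure_mono
    (show Function.support (g * f).1 ⊆ Function.support g.1 from
      fun y hy h0 => hy (show g y * f y = 0 by rw [show g y = 0 from h0, zero_mul]))
  have ha : Adapted (U ∩ V) (g * f) :=
    ⟨h.elementary.mono hUV Set.inter_subset_left, hs.trans fun x hx => (hgs hx).2⟩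
  have hV' : Adapted V (g * f) := e ▸ h'.mul (g * f)
  rw [Cc.piece_congr rfl e (h'.mul (g * f)), Cc.piece_shrink (h.mul g) ha Set.inter_subset_left,
    Cc.piece_shrink hV' ha Set.inter_subset_right]

theorem Cc.mk_piece_eq_zero {E : Shf n M} {U : Set E} {f : Rc 𝕜 n M} (h : Adapted U f)
    {x : M} (hx : x ∉ E.proj '' U) : Loc.mk 𝕜 n x (Cc.piece U f h) = 0 := by
  obtain ⟨η, h1, h2⟩ := h.exists_eta
  rw [← Cc.piece_congr rfl (mul_comm η f |>.symm.trans h2) (h1.mul f), ← Cc.act_piece h1]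
  exact Loc.mk_act_eq_zero (notMem_tsupport_iff_eventuallyEq.1 fun hf => hx (h.supp hf)) _

/-- The expansion of an element of `C_c^∞(E) ⊗ C_c^∞(E)` near `x`. -/
theorem Cc.exists_expansion {E : Shf n M} (x : M)
    (e : E.proj ⁻¹' {x} → Loc 𝕜 n x (Cc 𝕜 E))
    (he : ∀ (y : E.proj ⁻¹' {x}) (U : Set E) (f : Rc 𝕜 n M) (h : Adapted U f), y.1 ∈ U →
      Loc.mk 𝕜 n x (Cc.piece U f h) = act f (e y))
    (t : Cc 𝕜 E ⊗[Uz (Rc 𝕜 n M)] Cc 𝕜 E) :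
    ∃ a : (E.proj ⁻¹' {x} × E.proj ⁻¹' {x}) →₀ Rc 𝕜 n M,
      Loc.tensor 𝕜 n x (Cc 𝕜 E) t = a.sum (fun p r => act r (e p.1 ⊗ₜ e p.2)) ∧
      ∀ p : E.fiberProd E, ∀ hp : (E.fiberProd E).proj p = x,
        (omega E E t).1 p = (((a (⟨(Shf.fst E E).toFun p, hp⟩,
          ⟨(Shf.snd E E).toFun p, ((Shf.snd E E).proj_comp p).trans hp⟩)).1 ∘
            (E.fiberProd E).proj : E.fiberProd E → 𝕜) : Germ (𝓝 p) 𝕜) := by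
  classical
  let Q : Cc 𝕜 E ⊗[Uz (Rc 𝕜 n M)] Cc 𝕜 E → Prop := fun t =>
    ∃ a : (E.proj ⁻¹' {x} × E.proj ⁻¹' {x}) →₀ Rc 𝕜 n M,
      Loc.tensor 𝕜 n x (Cc 𝕜 E) t = a.sum (fun p r => act r (e p.1 ⊗ₜ e p.2)) ∧
      ∀ p : E.fiberProd E, ∀ hp : (E.fiberProd E).proj p = x,
        (omega E E t).1 p = (((a (⟨(Shf.fst E E).toFun p, hp⟩,
          ⟨(Shf.snd E E).toFun p, ((Shf.snd E E).proj_comp p).trans hp⟩)).1 ∘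
            (E.fiberProd E).proj : E.fiberProd E → 𝕜) : Germ (𝓝 p) 𝕜)
  have hQ0 : ∀ t, Loc.tensor 𝕜 n x (Cc 𝕜 E) t = 0 →
      (∀ p : E.fiberProd E, (E.fiberProd E).proj p = x → (omega E E t).1 p = 0) → Q t :=
    fun t h1 h2 => ⟨0, by rw [h1, Finsupp.sum_zero_index], fun p hp => by rw [h2 p hp]; rfl⟩
  have hQz : Q 0 := hQ0 0 (map_zero _) fun p hp => by rw [map_zero]; rfl
  have hQa : ∀ s t, Q s → Q t → Q (s + t) := by
    rintro s t ⟨a, h1, h2⟩ ⟨b, h3, h4⟩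
    refine ⟨a + b, ?_, fun p hp => ?_⟩
    · rw [map_add, h1, h3, Finsupp.sum_add_index']
      · intro p; rw [act, map_zero, zero_smul]
      · intro p r s; rw [add_act]
    · rw [map_add]
      exact congrArg₂ (· + ·) (h2 p hp) (h4 p hp)
  have hQp : ∀ (U : Set E) (f : Rc 𝕜 n M) (h : Adapted U f) (V : Set E) (g : Rc 𝕜 n M)
      (h' : Adapted V g), Q (Cc.piece U f h ⊗ₜ Cc.piece V g h') := by
    intro U f h V g h'
    have hom : (omega E E (Cc.piece U f h ⊗ₜ Cc.piece V g h')).1 =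
      extByZero (prodSet U V) ((f * g).1 ∘ (E.fiberProd E).proj) :=
      congrArg Subtype.val (omega_piece h h')
    by_cases hU : x ∈ E.proj '' U
    swap
    · refine hQ0 _ ?_ fun p hp => ?_
      · rw [TensorProduct.map_tmul]
        exact (congrArg (fun c => c ⊗ₜ _) (Cc.mk_piece_eq_zero h hU)).trans
          (TensorProduct.zero_tmul _ _)
      · have : p ∉ prodSet U V := fun hpU => hU ⟨_, hpU.1, hp⟩
        rw [hom, extByZero_of_notMem this]
    by_cases hV : x ∈ E.proj '' V
    swap
    · refine hQ0 _ ?_ fun p hp => ?_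
      · rw [TensorProduct.map_tmul]
        exact (congrArg (fun c => _ ⊗ₜ c) (Cc.mk_piece_eq_zero h' hV)).trans
          (TensorProduct.tmul_zero _ _)
      · have : p ∉ prodSet U V := fun hpU => hV ⟨_, hpU.2, ((Shf.snd E E).proj_comp p).trans hp⟩
        rw [hom, extByZero_of_notMem this]
    obtain ⟨y, hy, hyx⟩ := hU
    obtain ⟨z, hz, hzx⟩ := hV
    refine ⟨Finsupp.single (⟨y, hyx⟩, ⟨z, hzx⟩) (f * g), ?_, fun p hp => ?_⟩
    · rw [Finsupp.sum_single_index (by rw [act, map_zero, zero_smul]), TensorProduct.map_tmul]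
      refine (congrArg₂ (fun c d => c ⊗ₜ d) (he ⟨y, hyx⟩ U f h hy) (he ⟨z, hzx⟩ V g h' hz)).trans ?_
      rw [act_mul, act_tmul', act_tmul]
    · rw [hom]
      by_cases hpU : p ∈ prodSet U V
      · have e1 : (Shf.fst E E).toFun p = y := h.elementary.2 hpU.1 hy (hp.trans hyx.symm)
        have e2 : (Shf.snd E E).toFun p = z := h'.elementary.2 hpU.2 hz
          (((Shf.snd E E).proj_comp p).trans (hp.trans hzx.symm))
        subst e1; subst e2
        rw [extByZero_of_mem hpU, Finsupp.single_eq_same]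
      · rw [extByZero_of_notMem hpU, Finsupp.single_eq_of_ne]
        · rfl
        · intro heq
          have e1 : (Shf.fst E E).toFun p = y := congrArg (fun q => q.1.1) heq
          have e2 : (Shf.snd E E).toFun p = z := congrArg (fun q => q.2.1) heq
          refine hpU ⟨?_, ?_⟩
          · change (Shf.fst E E).toFun p ∈ U
            rw [e1]; exact hy
          · change (Shf.snd E E).toFun p ∈ V
            rw [e2]; exact hz
  change Q t
  induction t using TensorProduct.induction_on with
  | zero => exact hQz
  | tmul u v =>
    induction u using Cc.induction with
    | hz => rw [TensorProduct.zero_tmul]; exact hQz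
    | hp U f h =>
      induction v using Cc.induction with
      | hz => rw [TensorProduct.tmul_zero]; exact hQz
      | hp V g h' => exact hQp U f h V g h'
      | ha v w hv hw => rw [TensorProduct.tmul_add]; exact hQa _ _ hv hw
    | ha u w hu hw => rw [TensorProduct.add_tmul]; exact hQa _ _ hu hw
  | add s t hs ht => exact hQa _ _ hs ht

theorem omega_injective (E : Shf n M) : Function.Injective (omega (𝕜 := 𝕜) E E) := by
  refine (injective_iff_map_eq_zero _).2 fun t ht => ?_
  refine eq_zero_of_forall_nullAt (Cc.tensor_compactlyUnitary t) fun x => ?_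
  rw [← Loc.tensor_eq_zero_iff]
  choose V b hb hyV hb1 using Cc.exists_unit (𝕜 := 𝕜) E
  obtain ⟨a, h1, h2⟩ := Cc.exists_expansion x
    (fun y => Loc.mk 𝕜 n x (Cc.piece (V y.1) (b y.1) (hb y.1))) (by
      rintro ⟨y, rfl⟩ U f h hy
      exact Cc.mk_piece_eq h (hb y) hy (hyV y) (hb1 y)) t
  rw [h1]
  refine Finset.sum_eq_zero fun p _ => ?_
  obtain ⟨⟨y, hy⟩, ⟨z, hz⟩⟩ := p
  have h3 := h2 ⟨(y, z), Eq.trans hy (Eq.symm hz)⟩ hy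
  rw [ht] at h3
  have h4 : ((a (⟨y, hy⟩, ⟨z, hz⟩)).1) =ᶠ[𝓝 x] 0 := by
    have h5 := (Germ.coe_eq (f := 0)).1 h3
    have h6 := (E.fiberProd E).homeo.map_nhds_eq ⟨(y, z), Eq.trans hy (Eq.symm hz)⟩
    have h7 : (E.fiberProd E).proj ⟨(y, z), Eq.trans hy (Eq.symm hz)⟩ = x := hy
    rw [h7] at h6
    rw [EventuallyEq, ← h6, eventually_map]
    exact h5.mono fun w hw => hw.symm
  refine (act_tmul _ _ _).trans ?_
  exact (congrArg (fun c => c ⊗ₜ _) (Loc.mk_act_eq_zero h4 _)).trans (TensorProduct.zero_tmul _ _)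

/-- The isomorphism `Ω : C_c^∞(E) ⊗ C_c^∞(E) → C_c^∞(E ×_M E)`. -/
def omegaEquiv (E : Shf n M) :
    Cc 𝕜 E ⊗[Uz (Rc 𝕜 n M)] Cc 𝕜 E ≃ₗ[Uz (Rc 𝕜 n M)] Cc 𝕜 (E.fiberProd E) :=
  LinearEquiv.ofBijective (omega E E) ⟨omega_injective E, omega_surjective E E⟩

/-- The comultiplication `Ω⁻¹ ∘ diag_+`. -/
def Cc.comul (E : Shf n M) : Cc 𝕜 E →ₗ[Uz (Rc 𝕜 n M)] Cc 𝕜 E ⊗[Uz (Rc 𝕜 n M)] Cc 𝕜 E :=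
  (omegaEquiv E).symm.toLinearMap ∘ₗ Cc.push E.diag

theorem Cc.comul_piece {E : Shf n M} {U : Set E} {f η : Rc 𝕜 n M} (h : Adapted U f)
    (h' : Adapted U η) (hη : η * f = f) :
    Cc.comul E (Cc.piece U f h) = Cc.piece U f h ⊗ₜ Cc.piece U η h' := by
  refine (LinearEquiv.symm_apply_eq _).2 ?_
  refine (Cc.push_piece E.diag h).trans (Eq.trans ?_ (omega_piece h h').symm)
  refine Cc.piece_congr ?_ (by rw [mul_comm, hη]) _
  ext p
  constructor
  · rintro ⟨y, hy, rfl⟩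
    exact ⟨hy, hy⟩
  · rintro ⟨h1, h2⟩
    refine ⟨_, h1, Subtype.ext (Prod.ext rfl ?_)⟩
    exact h.elementary.2 h1 h2 p.2

variable (𝕜) in
/-- The coalgebra `C_c^∞(E)`. -/
def Cc.coalg (E : Shf n M) : Coalg (Rc 𝕜 n M) where
  carrier := Cc 𝕜 E
  locallyUnitary := Cc.locallyUnitary
  comul := Cc.comul E
  counit := Cc.counit E
  id_counit u := by
    induction u using Cc.induction with
    | hz => rw [map_zero, map_zero]
    | hp U f h =>
      obtain ⟨η, h1, h2⟩ := h.exists_eta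
      rw [Cc.comul_piece h h1 h2, idTensor_tmul, Cc.counit_piece, Cc.act_piece]
      exact (Cc.piece_congr rfl h2.symm h).symm
    | ha u v hu hv => rw [map_add, map_add, hu, hv]
  counit_id u := by
    induction u using Cc.induction with
    | hz => rw [map_zero, map_zero]
    | hp U f h =>
      obtain ⟨η, h1, h2⟩ := h.exists_eta
      rw [Cc.comul_piece h h1 h2, tensorId_tmul, Cc.counit_piece, Cc.act_piece]
      exact (Cc.piece_congr rfl (by rw [mul_comm, h2]) h).symm
    | ha u v hu hv => rw [map_add, map_add, hu, hv]

theorem Cc.push_comul {E F : Shf n M} (φ : E ⟶ F) (u : Cc 𝕜 E) :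
    TensorProduct.map (Cc.push φ) (Cc.push φ) (Cc.comul E u) = Cc.comul F (Cc.push φ u) := by
  induction u using Cc.induction with
  | hz => simp
  | hp U f h =>
    obtain ⟨η, h1, h2⟩ := h.exists_eta
    rw [Cc.comul_piece h h1 h2, TensorProduct.map_tmul, Cc.push_piece, Cc.push_piece,
      Cc.comul_piece (h.image φ) (h1.image φ) h2]
  | ha u v hu hv => simp only [map_add, hu, hv]

theorem Cc.push_counit {E F : Shf n M} (φ : E ⟶ F) (u : Cc 𝕜 E) :
    Cc.counit F (Cc.push φ u) = Cc.counit E u := by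
  induction u using Cc.induction with
  | hz => simp
  | hp U f h => rw [Cc.push_piece, Cc.counit_piece, Cc.counit_piece]
  | ha u v hu hv => simp only [map_add, hu, hv]

variable (𝕜 n M) in
/-- The functor `C_c^∞` from sheaves on `M` to coalgebras over `C_c^∞(M)`. -/
def ccFunctor : Shf n M ⥤ Coalg (Rc 𝕜 n M) where
  obj E := Cc.coalg 𝕜 E
  map {E F} φ := (⟨Cc.push φ, Cc.push_comul φ, Cc.push_counit φ⟩ :
    Coalg.Hom (Cc.coalg 𝕜 E) (Cc.coalg 𝕜 F))
  map_id E := Coalg.Hom.ext' fun u => by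
    change Cc.push (𝟙 E) u = u
    induction u using Cc.induction with
    | hz => simp
    | hp U f h =>
      rw [Cc.push_piece]
      exact (Cc.piece_congr (Set.image_id U).symm rfl h).symm
    | ha u v hu hv => rw [map_add, hu, hv]
  map_comp {E F G} φ ψ := Coalg.Hom.ext' fun u => by
    change Cc.push (φ ≫ ψ) u = Cc.push ψ (Cc.push φ u)
    induction u using Cc.induction with
    | hz => simp
    | hp U f h =>
      rw [Cc.push_piece, Cc.push_piece, Cc.push_piece]
      exact Cc.piece_congr (Set.image_comp ψ.toFun φ.toFun U) rfl (h.image (φ ≫ ψ))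
    | ha u v hu hv => simp only [map_add, hu, hv]

/-- If `f` equals `1` near `x`, the class of `f ∘ π|_U` at `x` is grouplike. -/
theorem Cc.piece_grouplike {E : Shf n M} {U : Set E} {f : Rc 𝕜 n M} (h : Adapted U f) {x : M}
    (hx : OneAt f x) :
    (Cc.coalg 𝕜 E).Grouplike x (Loc.mk 𝕜 n x (C := Cc.coalg 𝕜 E) (Cc.piece U f h)) := by
  refine Coalg.WeaklyGrouplike.grouplike ?_ ?_
  · obtain ⟨η, h1, h2⟩ := h.exists_eta
    exact ⟨_, Cc.comul_piece h h1 h2⟩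
  · have : (Cc.coalg 𝕜 E).counit (Cc.piece U f h) = f := Cc.counit_piece h
    rw [this]; exact hx

/-- The point `(f ∘ π|_U)_x` of the spectral sheaf of `C_c^∞(E)`. -/
def Cc.pieceAt {E : Shf n M} (U : Set E) (f : Rc 𝕜 n M) (h : Adapted U f) (x : M)
    (hx : OneAt f x) : (spectralFunctor 𝕜 n M).obj ((ccFunctor 𝕜 n M).obj E) :=
  (⟨x, _, Cc.piece_grouplike h hx⟩ : (Cc.coalg 𝕜 E).Sp)

end CoalgebraOfSheaf

end

end SheafCoalg

namespace SheafCoalg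

noncomputable section

variable {𝕜 : Type} [RCLike 𝕜] {n : ℕ} {M : Type u} [TopologicalSpace M]
  [ChartedSpace (EuclideanSpace ℝ (Fin n)) M] [IsManifold (𝓡 n) ∞ M]

/-! Write `R_x` for the ring of germs at `x`. The stalk `C_c^∞(E)_x` is the free `R_x`-module on the
fibre of `π` over `x`: the basis vector `e_y` is the class of any piece `f ∘ π|_U` with `y ∈ U` and
`f = 1` near `x`. A piece through `y` with arbitrary `f` has class `f e_y`, and a piece whose `U`
misses the fibre has class zero. As `diag_+` puts the germs of a section on the diagonal of `E ×_M
E`, every basis vector satisfies `Δ_x(e_y) = e_y ⊗ e_y` and `ε_x(e_y) = 1`; the stalk is the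
coalgebra of a set.

For such a coalgebra the grouplike elements are exactly the `e_y`. If `ζ = ∑ a_y e_y` is grouplike,
comparing coefficients of `Δ_x(ζ)` and `ζ ⊗ ζ` gives `a_y² = a_y` and `a_y a_z = 0` for `y ≠ z`,
while the counit gives `∑ a_y = 1`. The sum forces some `a_y` to be nonzero at `x`; an idempotent
germ that does not vanish at `x` is `1`, and orthogonality kills all the others. Hence `ζ = e_y`.

The formal argument needs no freeness. `Cc.exists_stalk_expansion` supplies coefficients `a_y` that
are at the same time the germs of the section at the points `y`, so coefficients are compared by
evaluating germs of `Ω(Δ u)` and `Ω(u ⊗ u)` at points of `E ×_M E`. `Cc.grouplike_eq_mk_piece`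
carries out the idempotent argument and yields surjectivity of `y ↦ e_y`. Injectivity
(`Cc.pieceAt_inj`) holds because a class at `x` determines the germs at all points over `x`
(`Cc.apply_eq_of_mk_eq`). Continuity (`Cc.continuous_toSpectral`) holds because one piece represents
`e_z` for all `z` near `y`. A bijective morphism of étale spaces is an isomorphism, and naturality
reduces to `φ_+` sending the piece `(U, f)` to the piece `(φ(U), f)`. -/

/-! ### Bijective morphisms, and germs pulled back from the base -/

/-- A bijective morphism of sheaves is an isomorphism. -/
def Shf.isoOfBijective {E F : Shf n M} (φ : E ⟶ F) (h : Function.Bijective φ.toFun) : E ≅ F where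
  hom := φ
  -- A morphism of sheaves is a local homeomorphism, so a bijective one is a homeomorphism.
  -- Smoothness of the inverse is automatic, since it is continuous and lies over `M`.
  inv := Shf.homMk (φ.homeo.toHomeomorphOfBijective h).symm
    (φ.homeo.toHomeomorphOfBijective h).symm.continuous fun z => by
      rw [← φ.proj_comp]
      exact congrArg F.proj ((φ.homeo.toHomeomorphOfBijective h).apply_symm_apply z)
  hom_inv_id := Shf.Hom.ext' fun y => (φ.homeo.toHomeomorphOfBijective h).symm_apply_apply y
  inv_hom_id := Shf.Hom.ext' fun z => (φ.homeo.toHomeomorphOfBijective h).apply_symm_apply z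

/-- A local homeomorphism maps the neighbourhood filter of `y` onto that of its image, so no
information on germs is lost upstairs. This turns identities of germs on `E` or on `E ×_M E` into
identities near `x` in `M`. The point `x` is a separate variable because points of a fibre lie over
`x` only by a propositional equality. -/
theorem Shf.germ_comp_proj_eq_iff {E : Shf n M} {f g : M → 𝕜} {y : E} {x : M}
    (hy : E.proj y = x) :
    ((f ∘ E.proj : E → 𝕜) : Germ (𝓝 y) 𝕜) = ((g ∘ E.proj : E → 𝕜) : Germ (𝓝 y) 𝕜) ↔
      f =ᶠ[𝓝 x] g := by
  subst hy
  rw [Germ.coe_eq, EventuallyEq, EventuallyEq, ← E.homeo.map_nhds_eq, eventually_map]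
  rfl

variable [T2Space M]

/-! ### Germs and stalk classes of pieces -/

theorem Cc.piece_apply_of_mem {E : Shf n M} {U : Set E} {f : Rc 𝕜 n M} (h : Adapted U f) {y : E}
    (hy : y ∈ U) : (Cc.piece U f h).1 y = ((f.1 ∘ E.proj : E → 𝕜) : Germ (𝓝 y) 𝕜) :=
  extByZero_of_mem hy

theorem Cc.piece_apply_of_notMem {E : Shf n M} {U : Set E} {f : Rc 𝕜 n M} (h : Adapted U f) {y : E}
    (hy : y ∉ U) : (Cc.piece U f h).1 y = 0 :=
  extByZero_of_notMem hy

/-- Elements of `C_c^∞(E)` with the same class at `x` have the same germs at the points over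
`x`. -/
theorem Cc.apply_eq_of_mk_eq {E : Shf n M} {u v : Cc 𝕜 E} {y : E}
    (h : Loc.mk 𝕜 n (E.proj y) u = Loc.mk 𝕜 n (E.proj y) v) : u.1 y = v.1 y := by
  obtain ⟨f, hf, h0⟩ := (Submodule.Quotient.eq _).1 h
  have h1 : (act f (u - v).1 : Sections 𝕜 E) y = 0 :=
    congrArg (fun w : Cc 𝕜 E => w.1 y) h0
  -- The function annihilating `u - v` has germ `1` at `π(y)`, so acting by it leaves the germ at
  -- `y` unchanged, and that germ must already be zero.
  have h2 : ((f.1 ∘ E.proj : E → 𝕜) : Germ (𝓝 y) 𝕜) = 1 :=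
    (Shf.germ_comp_proj_eq_iff (g := 1) rfl).2 hf
  rw [act_apply, h2, one_mul] at h1
  exact sub_eq_zero.1 h1

/-- Classes of pieces through `y` which are `1` near `π(y)` do not depend on the piece. -/
theorem Cc.mk_piece_unique {E : Shf n M} {U V : Set E} {f g : Rc 𝕜 n M} (h : Adapted U f)
    (h' : Adapted V g) {y : E} (hU : y ∈ U) (hV : y ∈ V) (hf : OneAt f (E.proj y))
    (hg : OneAt g (E.proj y)) :
    Loc.mk 𝕜 n (E.proj y) (Cc.piece U f h) = Loc.mk 𝕜 n (E.proj y) (Cc.piece V g h') :=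
  -- The first class is `f` times the second, and `f` acts as the identity on the stalk since its
  -- germ is `1`.
  (Cc.mk_piece_eq h h' hU hV hg).trans (Loc.act_eq hf _)

/-! ### Coordinates on the stalk of `C_c^∞(E)` -/

/-- The expansion of an element of `C_c^∞(E)` near `x`. -/
theorem Cc.exists_stalk_expansion {E : Shf n M} (x : M)
    (e : E.proj ⁻¹' {x} → Loc 𝕜 n x (Cc 𝕜 E))
    (he : ∀ (y : E.proj ⁻¹' {x}) (U : Set E) (f : Rc 𝕜 n M) (h : Adapted U f), y.1 ∈ U →
      Loc.mk 𝕜 n x (Cc.piece U f h) = act f (e y))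
    (u : Cc 𝕜 E) :
    ∃ a : E.proj ⁻¹' {x} →₀ Rc 𝕜 n M,
      Loc.mk 𝕜 n x u = a.sum (fun y r => act r (e y)) ∧
      (Cc.counit E u).1 =ᶠ[𝓝 x] (a.sum fun _ r => r).1 ∧
      (∀ y : E.proj ⁻¹' {x}, u.1 y.1 = (((a y).1 ∘ E.proj : E → 𝕜) : Germ (𝓝 y.1) 𝕜)) ∧
      (∀ y : E.proj ⁻¹' {x}, (omega E E (Cc.comul E u)).1 (E.diag.toFun y.1) =
        (((a y).1 ∘ (E.fiberProd E).proj : E.fiberProd E → 𝕜) : Germ (𝓝 (E.diag.toFun y.1)) 𝕜)) ∧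
      ∀ p : E.fiberProd E, (Shf.fst E E).toFun p ≠ (Shf.snd E E).toFun p →
        (omega E E (Cc.comul E u)).1 p = 0 := by
  classical
  -- As `Δ = Ω⁻¹ ∘ diag_+`, the clauses on the comultiplication are statements about germs of
  -- `diag_+ u`.
  have hom : ∀ u : Cc 𝕜 E, omega E E (Cc.comul E u) = Cc.push E.diag u := fun u =>
    (omegaEquiv E).apply_symm_apply _
  simp only [hom]
  -- All five clauses must hold for the same `a`, hence one induction for all. Each of them is
  -- additive in `u` and `a` together, so pieces are the only real case.
  induction u using Cc.induction with
  | hz =>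
    refine ⟨0, ?_, ?_, fun y => rfl, fun y => ?_, fun p hp => ?_⟩
    · exact (map_zero _).trans Finsupp.sum_zero_index.symm
    · rw [map_zero, Finsupp.sum_zero_index]
    · rw [map_zero]; rfl
    · rw [map_zero]; rfl
  | hp U f h =>
    -- The diagonal is injective because the first projection recovers `y`.
    have hdiag : ∀ y : E, E.diag.toFun y ∈ E.diag.toFun '' U ↔ y ∈ U := fun y =>
      ⟨fun ⟨z, hz, hzy⟩ => (show z = y from congrArg (Shf.fst E E).toFun hzy) ▸ hz,
        fun hy => ⟨y, hy, rfl⟩⟩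
    have hoff : ∀ p : E.fiberProd E, (Shf.fst E E).toFun p ≠ (Shf.snd E E).toFun p →
        (Cc.push E.diag (Cc.piece U f h)).1 p = 0 := fun p hp => by
      rw [Cc.push_piece, Cc.piece_apply_of_notMem]
      rintro ⟨z, hz, rfl⟩
      exact hp rfl
    have hout : ∀ y, y ∉ U → (Cc.push E.diag (Cc.piece U f h)).1 (E.diag.toFun y) = 0 :=
      fun y hy => by
        rw [Cc.push_piece, Cc.piece_apply_of_notMem _ fun h => hy ((hdiag y).1 h)]
    by_cases hx : x ∈ E.proj '' U
    · obtain ⟨y, hy, hyx⟩ := hx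
      -- As `U` is elementary, `y` is its only point over `x`, so the piece has a single coordinate,
      -- equal to `f`.
      refine ⟨Finsupp.single ⟨y, hyx⟩ f, ?_, ?_, fun z => ?_, fun z => ?_, hoff⟩
      · rw [Finsupp.sum_single_index (by rw [act, map_zero, zero_smul])]
        exact he ⟨y, hyx⟩ U f h hy
      · rw [Finsupp.sum_single_index rfl, Cc.counit_piece]
      -- The germs of `u` along the fibre and those of `diag_+ u` along the diagonal are computed
      -- alike: `f ∘ π` at `y`, and zero at the other points of the fibre, which lie outside `U`.
      all_goals
        by_cases hz : z = ⟨y, hyx⟩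
        · subst hz
          rw [Finsupp.single_eq_same]
          first
          | exact Cc.piece_apply_of_mem h hy
          | rw [Cc.push_piece]
            exact Cc.piece_apply_of_mem _ ((hdiag y).2 hy)
        · have hzU : z.1 ∉ U := fun hzU =>
            hz (Subtype.ext (h.elementary.2 hzU hy (Eq.trans z.2 hyx.symm)))
          rw [Finsupp.single_eq_of_ne hz]
          first
          | exact Cc.piece_apply_of_notMem h hzU
          | exact hout _ hzU
    · have hy : ∀ y : E.proj ⁻¹' {x}, y.1 ∉ U := fun y hy => hx ⟨y.1, hy, y.2⟩
      -- When `U` misses the fibre, all coordinates vanish; the counit `f` also vanishes near `x`,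
      -- since its closed support lies in `π(U)`.
      refine ⟨0, ?_, ?_, fun y => Cc.piece_apply_of_notMem h (hy y), fun y => hout _ (hy y), hoff⟩
      · rw [Finsupp.sum_zero_index]
        exact Cc.mk_piece_eq_zero h hx
      · rw [Finsupp.sum_zero_index, Cc.counit_piece]
        exact notMem_tsupport_iff_eventuallyEq.1 fun hf => hx (h.supp hf)
  | ha u v hu hv =>
    obtain ⟨a, h1, h2, h3, h4, h5⟩ := hu
    obtain ⟨b, k1, k2, k3, k4, k5⟩ := hv
    refine ⟨a + b, ?_, ?_, fun y => congrArg₂ (· + ·) (h3 y) (k3 y), fun y => ?_, fun p hp => ?_⟩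
    · refine (map_add _ u v).trans ((congrArg₂ (· + ·) h1 k1).trans (Eq.symm ?_))
      refine Finsupp.sum_add_index' ?_ ?_
      · intro p; rw [act, map_zero, zero_smul]
      · intro p r s; rw [add_act]
    · rw [map_add, Finsupp.sum_add_index' (fun _ => rfl) (fun _ _ _ => rfl)]
      exact h2.add k2
    · rw [map_add]
      exact congrArg₂ (· + ·) (h4 y) (k4 y)
    · rw [map_add]
      exact (congrArg₂ (· + ·) (h5 p hp) (k5 p hp)).trans (add_zero 0)

/-! ### Classification of the grouplike elements -/

/-- The grouplike elements of `C_c^∞(E)_x` are the classes of pieces. -/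
theorem Cc.grouplike_eq_mk_piece {E : Shf n M} {x : M} {ζ : Loc 𝕜 n x (Cc.coalg 𝕜 E)}
    (hζ : (Cc.coalg 𝕜 E).Grouplike x ζ) :
    ∃ y : E, E.proj y = x ∧ ∀ (U : Set E) (f : Rc 𝕜 n M) (h : Adapted U f), y ∈ U → OneAt f x →
      ζ = Loc.mk 𝕜 n x (C := Cc.coalg 𝕜 E) (Cc.piece U f h) := by
  obtain ⟨u, rfl⟩ := Submodule.mkQ_surjective _ ζ
  change Cc 𝕜 E at u
  have hone : OneAt (Cc.counit E u) x := ((Cc.coalg 𝕜 E).counitAt_mk_eq_one x u).1 hζ.2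
  -- The chosen piece at each `y` provides the basis vector `e_y` of the stalk.
  choose V b hb hyV hb1 using Cc.exists_unit (𝕜 := 𝕜) E
  have he : ∀ (y : E.proj ⁻¹' {x}) (U : Set E) (f : Rc 𝕜 n M) (h : Adapted U f), y.1 ∈ U →
      Loc.mk 𝕜 n x (Cc.piece U f h) =
        act f (Loc.mk 𝕜 n x (Cc.piece (V y.1) (b y.1) (hb y.1))) := by
    rintro ⟨y, rfl⟩ U f h hy
    exact Cc.mk_piece_eq h (hb y) hy (hyV y) (hb1 y)
  obtain ⟨a, h1, h2, h3, h4, h5⟩ := Cc.exists_stalk_expansion x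
    (fun y => Loc.mk 𝕜 n x (Cc.piece (V y.1) (b y.1) (hb y.1))) he u
  -- Equality of `Δ u` and `u ⊗ u` in the tensor square of the stalk means that their difference is
  -- annihilated by a function equal to `1` near `x`. This property passes through the linear map
  -- `Ω`, and so gives equal germs at all points over `x`.
  have hΔ : ∀ p : E.fiberProd E, (E.fiberProd E).proj p = x →
      (omega E E (Cc.comul E u)).1 p = (omega E E (u ⊗ₜ u)).1 p := by
    have h6 : Loc.tensor 𝕜 n x (Cc 𝕜 E) (Cc.comul E u - u ⊗ₜ u) = 0 := by
      rw [map_sub, TensorProduct.map_tmul, sub_eq_zero]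
      exact hζ.1
    obtain ⟨f, hf, h0⟩ := (Loc.tensor_eq_zero_iff _).1 h6
    rintro p rfl
    refine Cc.apply_eq_of_mk_eq ((Submodule.Quotient.eq _).2 ⟨f, hf, ?_⟩)
    rw [← map_sub]
    exact (map_act f _ (omega E E)).symm.trans ((congrArg _ h0).trans (map_zero _))
  -- The germ of `Ω(u ⊗ u)` at `(y, z)` is that of `a_y a_z`, pulled back from `M`.
  have hpull : ∀ p : E.fiberProd E, ∀ hp : (E.fiberProd E).proj p = x,
      (omega E E (u ⊗ₜ u)).1 p =
        ((((a ⟨(Shf.fst E E).toFun p, hp⟩) *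
          a ⟨(Shf.snd E E).toFun p, ((Shf.snd E E).proj_comp p).trans hp⟩).1 ∘
            (E.fiberProd E).proj : E.fiberProd E → 𝕜) : Germ (𝓝 p) 𝕜) := by
    intro p hp
    have e1 := h3 ⟨(Shf.fst E E).toFun p, hp⟩
    have e2 := h3 ⟨(Shf.snd E E).toFun p, ((Shf.snd E E).proj_comp p).trans hp⟩
    rw [omega_tmul, omegaFun]
    refine (congrArg₂ (fun s t => germEquiv _ (Shf.fst E E).homeo rfl s *
      germEquiv _ (Shf.snd E E).homeo rfl t) e1 e2).trans ?_
    -- The projection of `E ×_M E` is defined through the first factor; rewriting it through the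
    -- second uses the fibre product condition.
    have e3 : (E.fiberProd E).proj = E.proj ∘ (Shf.snd E E).toFun :=
      (funext (Shf.snd E E).proj_comp).symm
    set c := (a ⟨(Shf.snd E E).toFun p, ((Shf.snd E E).proj_comp p).trans hp⟩)
    have e4 : (((a ⟨(Shf.fst E E).toFun p, hp⟩) * c).1 ∘ (E.fiberProd E).proj) =
        (((a ⟨(Shf.fst E E).toFun p, hp⟩).1 ∘ E.proj) ∘ (Shf.fst E E).toFun) *
          ((c.1 ∘ E.proj) ∘ (Shf.snd E E).toFun) := by
      rw [Function.comp_assoc c.1, ← e3]; rfl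
    rw [e4]; rfl
  -- Compare germs at the diagonal point `(y, y)`, where `Ω(Δ u)` has coefficient `a_y`.
  have hidem : ∀ y, (a y).1 =ᶠ[𝓝 x] (a y * a y).1 := by
    rintro ⟨y, hy⟩
    have hp : (E.fiberProd E).proj (E.diag.toFun y) = x := hy
    exact (Shf.germ_comp_proj_eq_iff hp).1
      ((h4 ⟨y, hy⟩).symm.trans ((hΔ _ hp).trans (hpull _ hp)))
  -- Compare germs at the off-diagonal point `(y, z)`, where `Ω(Δ u)` vanishes.
  have horth : ∀ y z, y ≠ z → (0 : M → 𝕜) =ᶠ[𝓝 x] (a y * a z).1 := by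
    rintro ⟨y, hy⟩ ⟨z, hz⟩ hyz
    have hp : (E.fiberProd E).proj ⟨(y, z), Eq.trans hy (Eq.symm hz)⟩ = x := hy
    exact (Shf.germ_comp_proj_eq_iff (f := 0) hp).1
      ((h5 ⟨(y, z), Eq.trans hy (Eq.symm hz)⟩ fun h => hyz (Subtype.ext h)).symm.trans
        ((hΔ _ hp).trans (hpull _ hp)))
  -- The coefficients add up to the counit, whose value at `x` is `1`, so they cannot all vanish
  -- there.
  obtain ⟨y, hy⟩ : ∃ y, a y x ≠ 0 := by
    by_contra! h0
    have h6 : (Cc.counit E u) x = (a.sum fun _ r => r) x := h2.self_of_nhds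
    have h7 : (Cc.counit E u) x = 1 := hone.self_of_nhds
    have h8 : (a.sum fun _ r => r) x = 0 :=
      (map_finsuppSum (AddMonoidHom.mk' (fun r : Rc 𝕜 n M => r x) fun _ _ => rfl) a _).trans
        (Finset.sum_eq_zero fun y _ => h0 y)
    rw [h6, h8] at h7
    exact zero_ne_one h7
  -- By continuity `a_y` has no zero near `x`, so it can be cancelled from `a_y = a_y²`: an
  -- idempotent germ with nonzero value is `1`.
  have hy1 : OneAt (a y) x := by
    filter_upwards [hidem y, (a y).2.1.continuous.continuousAt.eventually_ne hy] with w h6 h7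
    exact mul_left_cancel₀ h7 ((h6 : a y w = a y w * a y w).symm.trans (mul_one _).symm)
  have hz0 : ∀ z, z ≠ y → (a z).1 =ᶠ[𝓝 x] 0 := fun z hz => by
    filter_upwards [hy1, horth z y hz] with w h6 h7
    have h8 : (0 : 𝕜) = a z w * a y w := h7
    rw [show a y w = 1 from h6, mul_one] at h8
    exact h8.symm
  refine ⟨y.1, y.2, fun U f h hyU hf => ?_⟩
  -- Both sides equal `e_y`: on the right because the given piece has class `f e_y` with `f = 1`
  -- near `x`, on the left because only the term at `y` survives in the expansion.
  refine Eq.trans h1 (Eq.trans ?_ (Eq.symm ((he y U f h hyU).trans (Loc.act_eq hf _))))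
  rw [Finsupp.sum, Finset.sum_eq_single y]
  · exact Loc.act_eq hy1 _
  · exact fun z _ hz => Loc.mk_act_eq_zero (hz0 z hz) _
  · intro hya
    rw [Finsupp.notMem_support_iff.1 hya, act, map_zero, zero_smul]

/-! ### The comparison map: independence of choices, continuity, bijectivity -/

/-- The point of the spectral sheaf of `C_c^∞(E)` given by a point of `E`. -/
def Cc.toSpectral (𝕜 : Type) [RCLike 𝕜] (E : Shf n M) (y : E) :
    (spectralFunctor 𝕜 n M).obj ((ccFunctor 𝕜 n M).obj E) :=
  Cc.pieceAt (Cc.exists_unit (𝕜 := 𝕜) E y).choose (Cc.exists_unit E y).choose_spec.choose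
    (Cc.exists_unit E y).choose_spec.choose_spec.1 (E.proj y)
    (Cc.exists_unit E y).choose_spec.choose_spec.2.2

/-- The map is defined by an arbitrary choice of piece at each point. Since the choice is immaterial
by `Cc.mk_piece_unique`, every later argument may work with a piece of its own, for instance a
single one for all nearby points. -/
theorem Cc.toSpectral_eq {E : Shf n M} {U : Set E} {f : Rc 𝕜 n M} (h : Adapted U f) {y : E}
    (hy : y ∈ U) (hf : OneAt f (E.proj y)) :
    Cc.toSpectral 𝕜 E y = Cc.pieceAt U f h (E.proj y) hf :=
  Coalg.Sp.ext' rfl (heq_of_eq (Cc.mk_piece_unique _ h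
    (Cc.exists_unit (𝕜 := 𝕜) E y).choose_spec.choose_spec.2.1 hy
    (Cc.exists_unit (𝕜 := 𝕜) E y).choose_spec.choose_spec.2.2 hf))

/-- Equal classes have equal germs at `y`. The first piece has germ `1` there, while the second
vanishes outside `V`; hence `y ∈ V`, and `π` is injective on `V`. -/
theorem Cc.pieceAt_inj {E : Shf n M} {U V : Set E} {f g : Rc 𝕜 n M} (h : Adapted U f)
    (h' : Adapted V g) {y z : E} (hy : y ∈ U) (hz : z ∈ V) (hf : OneAt f (E.proj y))
    (hg : OneAt g (E.proj z))
    (heq : Cc.pieceAt U f h (E.proj y) hf = Cc.pieceAt V g h' (E.proj z) hg) : y = z := by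
  have hp : E.proj y = E.proj z := congrArg Coalg.Sp.pt heq
  -- The values lie in stalks over the two base points, so their equality is heterogeneous. With the
  -- base points as free variables, one can be substituted for the other, which is not possible for
  -- `π(y)` and `π(z)`.
  have hv : ∀ (x x' : M) (hx : OneAt f x) (hx' : OneAt g x'),
      Cc.pieceAt U f h x hx = Cc.pieceAt V g h' x' hx' →
        Loc.mk 𝕜 n x (Cc.piece U f h) = Loc.mk 𝕜 n x (Cc.piece V g h') := by
    intro x x' hx hx' heq
    obtain rfl : x = x' := congrArg Coalg.Sp.pt heq
    exact eq_of_heq (Coalg.Sp.mk.inj heq).2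
  have h1 := Cc.apply_eq_of_mk_eq (hv _ _ hf hg heq)
  have hyV : y ∈ V := by
    by_contra hyV
    rw [Cc.piece_apply_of_mem h hy, Cc.piece_apply_of_notMem h' hyV] at h1
    have h2 := ((Shf.germ_comp_proj_eq_iff (g := 0) rfl).1 h1).self_of_nhds
    rw [hf.self_of_nhds] at h2
    exact one_ne_zero h2
  exact h'.elementary.2 hyV hz hp

/-- The piece `(U, f)` used at `y` also represents the image of every `z ∈ U` near `y`, because `f`
is `1` near `π(z)` as well. If its class agrees with that of `d` at `π(y)`, then it does so at all
nearby base points, the difference being annihilated by a function that is `1` on a whole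
neighbourhood. -/
theorem Cc.continuous_toSpectral (E : Shf n M) : Continuous (Cc.toSpectral 𝕜 E) := by
  refine continuous_iff_continuousAt.2 fun y => ?_
  obtain ⟨U, f, h, hyU, hf⟩ := Cc.exists_unit (𝕜 := 𝕜) E y
  refine ((Cc.coalg 𝕜 E).isTopologicalBasis.nhds_hasBasis.tendsto_right_iff).2 ?_
  rintro _ ⟨⟨d, W, hW, hd, hdW, rfl⟩, hp⟩
  change Cc.toSpectral 𝕜 E y ∈ _ at hp
  rw [Cc.toSpectral_eq h hyU hf] at hp
  obtain ⟨hp1, hp2⟩ := hp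
  obtain ⟨g, hg, h0⟩ := (Submodule.Quotient.eq _).1 hp2
  filter_upwards [h.elementary.1.mem_nhds hyU, E.homeo.continuous.continuousAt.eventually
    (((eventually_eventually_nhds.2 hg).and (eventually_eventually_nhds.2 hf)).and
      (hW.mem_nhds hp1))] with z hzU ⟨⟨hzg, hzf⟩, hzW⟩
  rw [Cc.toSpectral_eq h hzU hzf]
  exact ⟨hzW, (Submodule.Quotient.eq _).2 ⟨g, hzg, h0⟩⟩

theorem Cc.bijective_toSpectral (E : Shf n M) : Function.Bijective (Cc.toSpectral 𝕜 E) := by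
  constructor
  · intro y z hyz
    obtain ⟨U, f, h, hyU, hf⟩ := Cc.exists_unit (𝕜 := 𝕜) E y
    obtain ⟨V, g, h', hzV, hg⟩ := Cc.exists_unit (𝕜 := 𝕜) E z
    rw [Cc.toSpectral_eq h hyU hf, Cc.toSpectral_eq h' hzV hg] at hyz
    exact Cc.pieceAt_inj h h' hyU hzV hf hg hyz
  · rintro ⟨x, ζ, hζ⟩
    -- The grouplike element is the class of every piece that passes through `y` and is `1` near its
    -- base point, so any such piece identifies it with the image of `y`.
    obtain ⟨y, rfl, hy⟩ := Cc.grouplike_eq_mk_piece hζ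
    obtain ⟨U, f, h, hyU, hf⟩ := Cc.exists_unit (𝕜 := 𝕜) E y
    exact ⟨y, (Cc.toSpectral_eq h hyU hf).trans
      (Coalg.Sp.ext' rfl (heq_of_eq (hy U f h hyU hf).symm))⟩

/-- The isomorphism from `E` to the spectral sheaf of `C_c^∞(E)`. -/
def Cc.spectralIso (𝕜 : Type) [RCLike 𝕜] (E : Shf n M) :
    E ≅ (spectralFunctor 𝕜 n M).obj ((ccFunctor 𝕜 n M).obj E) :=
  Shf.isoOfBijective (Shf.homMk (Cc.toSpectral 𝕜 E) (Cc.continuous_toSpectral E) fun _ => rfl)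
    (Cc.bijective_toSpectral E)

/-! ### Naturality and the theorem -/

/-- A morphism over `M` is injective on the elementary set `U` and compatible with the projections,
so `φ_+` moves the set and keeps the function on the base. -/
theorem Cc.map_pieceAt {E F : Shf n M} (φ : E ⟶ F) {U : Set E} {f : Rc 𝕜 n M} (h : Adapted U f)
    (x : M) (hx : OneAt f x) :
    ((spectralFunctor 𝕜 n M).map ((ccFunctor 𝕜 n M).map φ)).toFun (Cc.pieceAt U f h x hx) =
      Cc.pieceAt (φ.toFun '' U) f (h.image φ) x hx :=
  Coalg.Sp.ext' rfl (heq_of_eq (congrArg (Loc.mk 𝕜 n x) (Cc.push_piece φ h)))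

theorem Cc.toSpectral_naturality {E F : Shf n M} (φ : E ⟶ F) (y : E) :
    Cc.toSpectral 𝕜 F (φ.toFun y) =
      ((spectralFunctor 𝕜 n M).map ((ccFunctor 𝕜 n M).map φ)).toFun (Cc.toSpectral 𝕜 E y) := by
  obtain ⟨U, f, h, hyU, hf⟩ := Cc.exists_unit (𝕜 := 𝕜) E y
  have hf' : OneAt f (F.proj (φ.toFun y)) := (φ.proj_comp y).symm ▸ hf
  rw [Cc.toSpectral_eq h hyU hf, Cc.map_pieceAt,
    Cc.toSpectral_eq (h.image φ) (Set.mem_image_of_mem _ hyU) hf']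
  -- Both sides now come from the same piece on `F`; they differ only in the base point, written as
  -- `π_F(φ(y))` on one side and `π_E(y)` on the other.
  congr 1
  exact φ.proj_comp y

end

end SheafCoalg

/-- The forward map of each component is `Cc.toSpectral` by definition, so the required formula, for
all admissible `U` and `f` at once, is the independence of choice in `Cc.toSpectral_eq`. -/
theorem theorem8 (𝕜 : Type) [RCLike 𝕜] (n : ℕ) (M : Type u) [TopologicalSpace M]
    [ChartedSpace (EuclideanSpace ℝ (Fin n)) M] [IsManifold (𝓡 n) ∞ M] [T2Space M] :
    ∃ Φ : 𝟭 (SheafCoalg.Shf n M) ≅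
        SheafCoalg.ccFunctor 𝕜 n M ⋙ SheafCoalg.spectralFunctor 𝕜 n M,
      ∀ (E : SheafCoalg.Shf n M) (y : E),
        (∃ (U : Set E) (f : SheafCoalg.Rc 𝕜 n M),
          SheafCoalg.Adapted U f ∧ y ∈ U ∧ SheafCoalg.OneAt f (E.proj y)) ∧
        ∀ (U : Set E) (f : SheafCoalg.Rc 𝕜 n M) (hU : SheafCoalg.Adapted U f)
          (hf : SheafCoalg.OneAt f (E.proj y)), y ∈ U →
          (Φ.hom.app E).toFun y = SheafCoalg.Cc.pieceAt U f hU (E.proj y) hf :=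
  ⟨NatIso.ofComponents (fun E => SheafCoalg.Cc.spectralIso 𝕜 E) fun φ =>
      SheafCoalg.Shf.Hom.ext' fun y => SheafCoalg.Cc.toSpectral_naturality φ y,
    fun E y => ⟨SheafCoalg.Cc.exists_unit E y, fun _ _ hU hf hy =>
      SheafCoalg.Cc.toSpectral_eq hU hy hf⟩⟩
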